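/- **Setting.** A (fully interactive) protocol in the local model consists of $n$ agents $P_1,\dots,P_n$, where $P_i$ holds a single input $y_i$ from a data domain $X$, and a referee without input. All parties are randomized, with independent coins. The agents communicate only with the referee: in each step the referee selects an agent and sends it a message, which may depend on the referee's coins and on all answers received so far, and that agent answers with one message, which depends on its input, its coins and the messages it has seen. After the agents have sent a total of $r$ messages, the referee writes an output; $r$ is the number of messages sent by the agents to the referee. The protocol is $\varepsilon$-differentially private if for every agent $P_i$, every randomized interactive adversary $A$ that talks to $P_i$ in place of all other parties (sending it arbitrary messages), all $x,x'\in X$, and every measurable event $T$, the output $A_{P_i}(x)$ of $A$ after its interaction with $P_i$ on input $x$ satisfies $\Pr[A_{P_i}(x)\in T]\le e^{\varepsilon}\,\Pr[A_{P_i}(x')\in T]$. The protocol solves the selection problem over $\{0,1\}^d$ with error $\alpha$ if $X=\{0,1\}^d$, its output is a coordinate $j\in\{1,\dots,d\}$, and for every probability distribution $\mathcal D$ on $\{0,1\}^d$ with mean $\mu=(\mu_1,\dots,\mu_d)$, when the inputs $Y=(y_1,\dots,y_n)$ are i.i.d. samples from $\mathcal D$, one has $\mathbb E[\mu_j]\ge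 \max_k\mu_k-\alpha$, where the expectation is over $Y$ and the coins of all parties. **Theorem.** There is an absolute constant $c>0$ such that for every $d\ge 2$ and every $n$, every $1$-differentially private protocol in the local model with $n$ agents that solves the selection problem over $\{0,1\}^d$ with error $\alpha=1/10$ has at least $c\,d^{1/3}$ messages sent by the agents to the referee. -/

import Mathlib

open MeasureTheory

universe u v w

/-- An agent of an interactive protocol: an interactive randomized functionality with input in `X`,
receiving messages in `Q` and answering each of them by a message in `M`.
`start x` is the law of the initial state, which holds the input `x` and all the random coins of
the agent; afterwards each answer, and the new state, is a function of the current state (input,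
coins, messages seen so far) and the message just received. -/
structure Agent (X : Type v) (Q M : Type u) [MeasurableSpace Q] [MeasurableSpace M] where
  State : Type u
  [measurableSpace : MeasurableSpace State]
  start : X → Measure State
  [isProbabilityMeasure : ∀ x, IsProbabilityMeasure (start x)]
  respond : State × Q → M × State
  measurable_respond : Measurable respond

/-- The asking side of an interaction: a randomized functionality without input that sends
queries in `Q`, receives an answer in `M` to each of them, and in the end writes an output in `O`.
`start` is the law of the initial state, which holds all the random coins. -/
structure Interrogator (Q M : Type u) (O : Type w)
    [MeasurableSpace Q] [MeasurableSpace M] [MeasurableSpace O] where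
  State : Type u
  [measurableSpace : MeasurableSpace State]
  start : Measure State
  [isProbabilityMeasure : IsProbabilityMeasure start]
  query : State → Q
  measurable_query : Measurable query
  receive : State × M → State
  measurable_receive : Measurable receive
  output : State → O
  measurable_output : Measurable output

attribute [instance] Agent.measurableSpace Agent.isProbabilityMeasure
  Interrogator.measurableSpace Interrogator.isProbabilityMeasure

/-- Two laws are `(ε, δ)`-close. -/
def DPClose {Ω : Type*} [MeasurableSpace Ω] (ε δ : ℝ) (μ ν : Measure Ω) : Prop :=
  ∀ T : Set Ω, MeasurableSet T →
    μ T ≤ ENNReal.ofReal (Real.exp ε) * ν T + ENNReal.ofReal δ ∧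
    ν T ≤ ENNReal.ofReal (Real.exp ε) * μ T + ENNReal.ofReal δ

noncomputable section

namespace Agent

variable {X : Type v} {Q M : Type u} {O : Type w}
  [MeasurableSpace Q] [MeasurableSpace M] [MeasurableSpace O]

/-- One exchange between an adversary `A` and the agent `P`: `A` sends a message, `P` answers. -/
def exchange (P : Agent X Q M) (A : Interrogator Q M O) (s : A.State × P.State) :
    A.State × P.State :=
  let answer := P.respond (s.2, A.query s.1)
  (A.receive (s.1, answer.1), answer.2)

/-- The law of the output of the adversary `A` that halts after `N` exchanges with the agent `P`
whose input is `x`. -/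
def adversaryOutput (P : Agent X Q M) (A : Interrogator Q M O) (N : ℕ) (x : X) : Measure O :=
  (A.start.prod (P.start x)).map fun s => A.output ((P.exchange A)^[N] s).1

lemma measurable_exchange (P : Agent X Q M) (A : Interrogator Q M O) :
    Measurable (P.exchange A) := by
  have h : Measurable fun s : A.State × P.State => P.respond (s.2, A.query s.1) :=
    P.measurable_respond.comp (measurable_snd.prodMk (A.measurable_query.comp measurable_fst))
  exact (A.measurable_receive.comp (measurable_fst.prodMk (measurable_fst.comp h))).prodMk
    (measurable_snd.comp h)

instance (P : Agent X Q M) (A : Interrogator Q M O) (N : ℕ) (x : X) :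
    IsProbabilityMeasure (P.adversaryOutput A N x) :=
  Measure.isProbabilityMeasure_map
    (A.measurable_output.comp
      (measurable_fst.comp ((P.measurable_exchange A).iterate N))).aemeasurable

end Agent

/-- A (fully interactive) protocol in the local model: `n` agents, each holding one input in `X`,
and a referee without input. The referee repeatedly selects an agent and sends it a message, and
that agent answers by one message; the selected agent and the message sent to it may depend on the
coins of the referee and on all previous answers. The agents send `messages` messages in total
(padded to the worst case); then the referee writes the output in `O`. -/
structure LocalProtocol (X : Type v) (Q M : Type u) (O : Type w)
    [MeasurableSpace Q] [MeasurableSpace M] [MeasurableSpace O] (n : ℕ) where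
  agent : Fin n → Agent X Q M
  referee : Interrogator (Fin n × Q) M O
  messages : ℕ

namespace LocalProtocol

variable {X : Type v} {Q M : Type u} {O : Type w}
  [MeasurableSpace Q] [MeasurableSpace M] [MeasurableSpace O] {n : ℕ}

/-- The joint state of the referee and all agents. -/
abbrev Config (P : LocalProtocol X Q M O n) : Type u :=
  P.referee.State × (∀ i, (P.agent i).State)

/-- One exchange: the referee sends a message to an agent, which answers. -/
def step (P : LocalProtocol X Q M O n) (s : P.Config) : P.Config :=
  let i := (P.referee.query s.1).1
  let answer := (P.agent i).respond (s.2 i, (P.referee.query s.1).2)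
  (P.referee.receive (s.1, answer.1), Function.update s.2 i answer.2)

/-- The law of the output of the referee when the inputs of the agents are `z`; the coins of the
parties are independent. -/
def outcome (P : LocalProtocol X Q M O n) (z : Fin n → X) : Measure O :=
  (P.referee.start.prod (Measure.pi fun i => (P.agent i).start (z i))).map
    fun s => P.referee.output (P.step^[P.messages] s).1

/-- `(ε, δ)`-differential privacy against arbitrary (malicious) adversaries that control everybody
but one agent. As every agent holds a single input, any two inputs are neighboring. -/
def IsDP (P : LocalProtocol X Q M O n) (ε δ : ℝ) : Prop :=
  ∀ (i : Fin n) (Out : Type u) [MeasurableSpace Out] (A : Interrogator Q M Out) (N : ℕ) (x x' : X),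
    DPClose ε δ ((P.agent i).adversaryOutput A N x) ((P.agent i).adversaryOutput A N x')

lemma measurable_step (P : LocalProtocol X Q M O n) : Measurable P.step := by
  have hq : Measurable fun s : P.Config => P.referee.query s.1 :=
    P.referee.measurable_query.comp measurable_fst
  have key : ∀ i : Fin n, Measurable fun s : P.Config =>
      (P.referee.receive (s.1, ((P.agent i).respond (s.2 i, (P.referee.query s.1).2)).1),
        Function.update s.2 i ((P.agent i).respond (s.2 i, (P.referee.query s.1).2)).2) := by
    intro i
    have h : Measurable fun s : P.Config =>
        (P.agent i).respond (s.2 i, (P.referee.query s.1).2) :=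
      (P.agent i).measurable_respond.comp
        (((measurable_pi_apply i).comp measurable_snd).prodMk (measurable_snd.comp hq))
    refine (P.referee.measurable_receive.comp
      (measurable_fst.prodMk (measurable_fst.comp h))).prodMk ?_
    exact measurable_update'.comp (measurable_snd.prodMk (measurable_snd.comp h))
  exact measurable_from_prod_countable_right (f := fun p : Fin n × P.Config =>
      (P.referee.receive (p.2.1, ((P.agent p.1).respond (p.2.2 p.1, (P.referee.query p.2.1).2)).1),
        Function.update p.2.2 p.1
          ((P.agent p.1).respond (p.2.2 p.1, (P.referee.query p.2.1).2)).2)) key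
    |>.comp ((measurable_fst.comp hq).prodMk measurable_id)

instance (P : LocalProtocol X Q M O n) (z : Fin n → X) : IsProbabilityMeasure (P.outcome z) :=
  Measure.isProbabilityMeasure_map
    (P.referee.measurable_output.comp
      (measurable_fst.comp (P.measurable_step.iterate P.messages))).aemeasurable

end LocalProtocol

/-- The `k`-th coordinate of the mean of a distribution on `{0,1}^d`. -/
def coordMean {d : ℕ} (D : Measure (Fin d → Bool)) (k : Fin d) : ℝ :=
  D.real {y | y k = true}

/-- The protocol solves the selection problem over `{0,1}^d` with error `α`: for every distribution
`D`, if the inputs `Y` of the agents are i.i.d. samples from `D`, then the output `j` satisfies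
`E[μ_j] ≥ max_k μ_k - α`, where `μ` is the mean of `D` and the expectation is over `Y` and the
coins of all parties. -/
def LocalProtocol.SolvesSelection {d n : ℕ} {Q M : Type u} [MeasurableSpace Q] [MeasurableSpace M]
    (P : LocalProtocol (Fin d → Bool) Q M (Fin d) n) (α : ℝ) : Prop :=
  ∀ D : Measure (Fin d → Bool), IsProbabilityMeasure D → ∀ k : Fin d,
    coordMean D k - α ≤
      ∫ Y : Fin n → Fin d → Bool, (∫ j, coordMean D j ∂(P.outcome Y)) ∂(Measure.pi fun _ => D)

end

/-!
Let `ν` be the uniform law on `{0,1}^d` and `s_k` the `k`-th coordinate as a sign. Under the tilted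
law with density `1 + s_k`, coordinate `k` has mean `1` and every other coordinate has mean `1/2`,
so a good protocol outputs `k` with probability close to `1`; under `ν` itself no output can be
likely for more than a few `k`.

Given the transcript of the referee, the inputs remain independent. Hence the likelihood ratio
between inputs from the `k`-th tilted law and inputs from `ν`, averaged over a transcript, is
`∏ i, (1 + b i k)`, where `b i k` is the conditional expectation of `s_k` of the `i`-th input, and
it is at least `1 - ∑ i, |b i k|`. Privacy bounds the joint law of the `i`-th input and the
transcript by `e^ε` times the product of its marginals, and under the product
`|∑ k, ± s_k|` has mean at most `√d` by orthogonality, whatever signs the transcript selects. So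
`∑ k, E |b i k|` is at most `e^ε √d` times the probability that agent `i` is ever asked. At most
`messages` agents are asked in a run, so the average loss over the `d` tilts is at most
`e^ε messages / √d`, which forces `messages` to be of order `√d`, and `√d ≥ d^(1/3)`.
-/

open ProbabilityTheory
open scoped ENNReal

section ConditionalIndependence

variable {Ω : Type*} {mΩ : MeasurableSpace Ω} {μ : Measure Ω}

lemma integral_mul_eq_integral_condExp_mul {m : MeasurableSpace Ω} (hm : m ≤ mΩ)
    [SigmaFinite (μ.trim hm)] {f g : Ω → ℝ} (hf : Integrable f μ) (hg : StronglyMeasurable[m] g)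
    (hfg : Integrable (f * g) μ) : ∫ ω, f ω * g ω ∂μ = ∫ ω, (μ[f|m]) ω * g ω ∂μ :=
  calc ∫ ω, f ω * g ω ∂μ = ∫ ω, (μ[f * g|m]) ω ∂μ := (integral_condExp hm).symm
    _ = _ := integral_congr_ae (condExp_mul_of_stronglyMeasurable_right hg hfg hf)

lemma setIntegral_inter_eq_integral_indicator_mul {V W : Set Ω} (hV : MeasurableSet V)
    (hW : MeasurableSet W) (f : Ω → ℝ) :
    ∫ ω in V ∩ W, f ω ∂μ = ∫ ω, V.indicator 1 ω * W.indicator f ω ∂μ := by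
  rw [← integral_indicator (hV.inter hW), ← Set.indicator_indicator]
  refine integral_congr_ae (.of_forall fun ω => ?_)
  by_cases hω : ω ∈ V <;> simp [hω]

lemma isPiSystem_image2_inter {m₁ m₂ : MeasurableSpace Ω} :
    IsPiSystem (Set.image2 (· ∩ ·) {V | MeasurableSet[m₁] V} {W | MeasurableSet[m₂] W}) := by
  rintro _ ⟨V, hV, W, hW, rfl⟩ _ ⟨V', hV', W', hW', rfl⟩ -
  exact ⟨V ∩ V', hV.inter hV', W ∩ W', hW.inter hW', Set.inter_inter_inter_comm V V' W W'⟩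

lemma generateFrom_image2_inter (m₁ m₂ : MeasurableSpace Ω) :
    MeasurableSpace.generateFrom
      (Set.image2 (· ∩ ·) {V | MeasurableSet[m₁] V} {W | MeasurableSet[m₂] W}) = m₁ ⊔ m₂ := by
  refine le_antisymm (MeasurableSpace.generateFrom_le ?_) (sup_le (fun V hV => ?_) fun W hW => ?_)
  · rintro _ ⟨V, hV, W, hW, rfl⟩
    exact MeasurableSet.inter (le_sup_left (a := m₁) (b := m₂) V hV)
      (le_sup_right (a := m₁) (b := m₂) W hW)
  · exact .basic _ ⟨V, hV, Set.univ, .univ, Set.inter_univ V⟩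
  · exact .basic _ ⟨Set.univ, .univ, W, hW, Set.univ_inter W⟩

lemma setIntegral_eq_of_forall_inter {m₁ m₂ : MeasurableSpace Ω} (h₁ : m₁ ≤ mΩ) (h₂ : m₂ ≤ mΩ)
    {f g : Ω → ℝ} (hf : Integrable f μ) (hg : Integrable g μ)
    (h : ∀ V W, MeasurableSet[m₁] V → MeasurableSet[m₂] W →
      ∫ ω in V ∩ W, f ω ∂μ = ∫ ω in V ∩ W, g ω ∂μ) {s : Set Ω} (hs : MeasurableSet[m₁ ⊔ m₂] s) :
    ∫ ω in s, f ω ∂μ = ∫ ω in s, g ω ∂μ := by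
  have hle : m₁ ⊔ m₂ ≤ mΩ := sup_le h₁ h₂
  have huniv : ∫ ω, f ω ∂μ = ∫ ω, g ω ∂μ := by simpa using h Set.univ Set.univ .univ .univ
  induction s, hs using
    MeasurableSpace.induction_on_inter (generateFrom_image2_inter m₁ m₂).symm
      isPiSystem_image2_inter with
  | empty => simp
  | basic s hs =>
    obtain ⟨V, hV, W, hW, rfl⟩ := hs
    exact h V W hV hW
  | compl s hs ih =>
    rw [setIntegral_compl (hle s hs) hf, setIntegral_compl (hle s hs) hg, ih, huniv]
  | iUnion s hd hs ih =>
    simp only [integral_iUnion (fun i => hle _ (hs i)) hd hf.integrableOn,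
      integral_iUnion (fun i => hle _ (hs i)) hd hg.integrableOn, ih]

/-- Conditional independence of the σ-algebras `A` and `B` given `G`, expressed by conditional
expectations: once `G` is known, `A` does not help to predict `B`. Mathlib's
`ProbabilityTheory.CondIndep` is not used, as it asks for a standard Borel space, whereas the state
spaces of the parties are arbitrary. -/
def CondIndepGiven {Ω : Type*} {_ : MeasurableSpace Ω} (μ : Measure Ω)
    (A B G : MeasurableSpace Ω) : Prop :=
  ∀ f : Ω → ℝ, StronglyMeasurable[B] f → Integrable f μ → μ[f|A ⊔ G] =ᵐ[μ] μ[f|G]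

namespace CondIndepGiven

variable [IsProbabilityMeasure μ] {A B G : MeasurableSpace Ω}

lemma of_indep (hA : A ≤ mΩ) (hB : B ≤ mΩ) (h : Indep A B μ) : CondIndepGiven μ A B ⊥ := by
  intro f hf _
  rw [sup_bot_eq, condExp_bot]
  exact condExp_indep_eq hB hA hf h.symm

lemma setIntegral_inter (h : CondIndepGiven μ A B G) (hA : A ≤ mΩ) (hB : B ≤ mΩ) (hG : G ≤ mΩ)
    {f : Ω → ℝ} (hf : StronglyMeasurable[A] f) (hfi : Integrable f μ) {V W : Set Ω}
    (hV : MeasurableSet[B] V) (hW : MeasurableSet[G] W) :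
    ∫ ω in V ∩ W, f ω ∂μ = ∫ ω in V ∩ W, (μ[f|G]) ω ∂μ := by
  have hVi : Integrable (V.indicator (1 : Ω → ℝ)) μ :=
    (integrable_const (1 : ℝ)).indicator (hB V hV)
  have hVbdd : ∀ ω, |V.indicator (1 : Ω → ℝ) ω| ≤ 1 := fun ω => by
    by_cases hω : ω ∈ V <;> simp [hω]
  have hpbdd : ∀ᵐ ω ∂μ, |(μ[V.indicator (1 : Ω → ℝ)|G]) ω| ≤ 1 :=
    ae_bdd_abs_condExp_of_ae_bdd_abs (R := (1 : ℝ)) (.of_forall hVbdd)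
  have hp := integrable_condExp (μ := μ) (m := G) (f := V.indicator (1 : Ω → ℝ))
  have hWf := hfi.indicator (hG W hW)
  have hWq := (integrable_condExp (μ := μ) (m := G) (f := f)).indicator (hG W hW)
  calc ∫ ω in V ∩ W, f ω ∂μ
    _ = ∫ ω, V.indicator 1 ω * W.indicator f ω ∂μ :=
        setIntegral_inter_eq_integral_indicator_mul (hB V hV) (hG W hW) f
    _ = ∫ ω, (μ[V.indicator (1 : Ω → ℝ)|A ⊔ G]) ω * W.indicator f ω ∂μ :=
        integral_mul_eq_integral_condExp_mul (sup_le hA hG) hVi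
          ((hf.mono le_sup_left).indicator (le_sup_right (a := A) (b := G) W hW))
          (hWf.bdd_mul hVi.aestronglyMeasurable (.of_forall hVbdd))
    _ = ∫ ω, f ω * W.indicator (μ[V.indicator (1 : Ω → ℝ)|G]) ω ∂μ := by
        refine integral_congr_ae ?_
        filter_upwards [h _ (stronglyMeasurable_one.indicator hV) hVi] with ω hω
        by_cases hωW : ω ∈ W <;> simp [hω, hωW, mul_comm]
    _ = ∫ ω, (μ[f|G]) ω * W.indicator (μ[V.indicator (1 : Ω → ℝ)|G]) ω ∂μ :=
        integral_mul_eq_integral_condExp_mul hG hfi (stronglyMeasurable_condExp.indicator hW)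
          (hfi.mul_bdd (hp.indicator (hG W hW)).aestronglyMeasurable (c := 1)
            (hpbdd.mono fun ω hω => (norm_indicator_le_norm_self _ _).trans hω))
    _ = ∫ ω, (μ[V.indicator (1 : Ω → ℝ)|G]) ω * W.indicator (μ[f|G]) ω ∂μ := by
        refine integral_congr_ae (.of_forall fun ω => ?_)
        by_cases hωW : ω ∈ W <;> simp [hωW, mul_comm]
    _ = ∫ ω, V.indicator 1 ω * W.indicator (μ[f|G]) ω ∂μ :=
        (integral_mul_eq_integral_condExp_mul hG hVi (stronglyMeasurable_condExp.indicator hW)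
          (hWq.bdd_mul hVi.aestronglyMeasurable (.of_forall hVbdd))).symm
    _ = ∫ ω in V ∩ W, (μ[f|G]) ω ∂μ :=
        (setIntegral_inter_eq_integral_indicator_mul (hB V hV) (hG W hW) _).symm

lemma symm (h : CondIndepGiven μ A B G) (hA : A ≤ mΩ) (hB : B ≤ mΩ) (hG : G ≤ mΩ) :
    CondIndepGiven μ B A G := by
  intro f hf hfi
  refine (ae_eq_condExp_of_forall_setIntegral_eq (sup_le hB hG) hfi
    (fun _ _ _ => integrable_condExp.integrableOn) (fun s hs _ => ?_)
    (stronglyMeasurable_condExp.mono (le_sup_right : G ≤ B ⊔ G)).aestronglyMeasurable).symm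
  exact setIntegral_eq_of_forall_inter hB hG integrable_condExp hfi
    (fun V W hV hW => (h.setIntegral_inter hA hB hG hf hfi hV hW).symm) hs

lemma reveal_left (h : CondIndepGiven μ A B G) (hA : A ≤ mΩ) (hG : G ≤ mΩ)
    {m : MeasurableSpace Ω} (hm : m ≤ A ⊔ G) : CondIndepGiven μ A B (G ⊔ m) := by
  intro f hf hfi
  have hle : G ⊔ m ≤ A ⊔ G := sup_le le_sup_right hm
  have hAG : A ⊔ (G ⊔ m) = A ⊔ G :=
    le_antisymm (sup_le le_sup_left hle) (sup_le_sup_left le_sup_left A)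
  rw [hAG]
  calc μ[f|A ⊔ G]
    _ =ᵐ[μ] μ[f|G] := h f hf hfi
    _ =ᵐ[μ] μ[μ[f|G]|G ⊔ m] := by
        rw [condExp_of_stronglyMeasurable (hle.trans (sup_le hA hG))
          (stronglyMeasurable_condExp.mono le_sup_left) integrable_condExp]
    _ =ᵐ[μ] μ[μ[f|A ⊔ G]|G ⊔ m] := condExp_congr_ae (h f hf hfi).symm
    _ =ᵐ[μ] μ[f|G ⊔ m] := condExp_condExp_of_le hle (sup_le hA hG)

lemma reveal_right (h : CondIndepGiven μ A B G) (hA : A ≤ mΩ) (hB : B ≤ mΩ) (hG : G ≤ mΩ)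
    {m : MeasurableSpace Ω} (hm : m ≤ B ⊔ G) : CondIndepGiven μ A B (G ⊔ m) :=
  ((h.symm hA hB hG).reveal_left hB hG hm).symm hB hA
    (sup_le hG (hm.trans (sup_le hB hG)))

lemma reveal_piecewise {R : Type*} [mR : MeasurableSpace R] [Nonempty R]
    (h : CondIndepGiven μ A B G) (hA : A ≤ mΩ) (hB : B ≤ mΩ) (hG : G ≤ mΩ) {E : Set Ω}
    [DecidablePred (· ∈ E)] (hE : MeasurableSet[G] E) {fA fB : Ω → R} (hfA : Measurable[A ⊔ G] fA)
    (hfB : Measurable[B ⊔ G] fB) : CondIndepGiven μ A B (G ⊔ mR.comap (E.piecewise fA fB)) := by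
  let r : Ω → R := fun _ => Classical.arbitrary R
  have hr : ∀ m : MeasurableSpace Ω, Measurable[m] r := fun _ => measurable_const
  have hleft : Measurable[A ⊔ G] (E.piecewise fA r) :=
    hfA.piecewise (le_sup_right (a := A) E hE) (hr _)
  have hright : Measurable[B ⊔ G] (E.piecewise r fB) :=
    (hr _).piecewise (le_sup_right (a := B) E hE) hfB
  have hsplit : G ⊔ mR.comap (E.piecewise fA fB) =
      G ⊔ mR.comap (E.piecewise fA r) ⊔ mR.comap (E.piecewise r fB) := by
    apply le_antisymm
    · refine sup_le (le_sup_left.trans le_sup_left) (Measurable.comap_le ?_)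
      rw [show E.piecewise fA fB = E.piecewise (E.piecewise fA r) (E.piecewise r fB) by
        ext ω; by_cases hω : ω ∈ E <;> simp [hω]]
      exact ((comap_measurable _).mono (le_sup_right.trans le_sup_left) le_rfl).piecewise
        ((le_sup_left.trans le_sup_left : G ≤ _) E hE)
        ((comap_measurable _).mono le_sup_right le_rfl)
    · have hE' := le_sup_left (a := G) (b := mR.comap (E.piecewise fA fB)) E hE
      have hf : Measurable[G ⊔ mR.comap (E.piecewise fA fB)] (E.piecewise fA fB) :=
        (comap_measurable _).mono le_sup_right le_rfl
      refine sup_le (sup_le le_sup_left (Measurable.comap_le ?_)) (Measurable.comap_le ?_)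
      · rw [show E.piecewise fA r = E.piecewise (E.piecewise fA fB) r by
          ext ω; by_cases hω : ω ∈ E <;> simp [hω]]
        exact hf.piecewise hE' (hr _)
      · rw [show E.piecewise r fB = E.piecewise r (E.piecewise fA fB) by
          ext ω; by_cases hω : ω ∈ E <;> simp [hω]]
        exact (hr _).piecewise hE' hf
  rw [hsplit]
  exact (h.reveal_left hA hG hleft.comap_le).reveal_right hA hB
    (sup_le hG (hleft.comap_le.trans (sup_le hA hG)))
    (hright.comap_le.trans (sup_le_sup_left le_sup_left B))

lemma condExp_mul (h : CondIndepGiven μ A B G) (hA : A ≤ mΩ) (hG : G ≤ mΩ) {f g : Ω → ℝ}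
    (hf : StronglyMeasurable[A] f) (hfi : Integrable f μ) (hg : StronglyMeasurable[B] g)
    (hgi : Integrable g μ) {C : ℝ} (hC : ∀ ω, |g ω| ≤ C) :
    μ[f * g|G] =ᵐ[μ] μ[f|G] * μ[g|G] := by
  have hfg : Integrable (f * g) μ := hfi.mul_bdd hgi.aestronglyMeasurable (.of_forall hC)
  have hCq : ∀ᵐ ω ∂μ, ‖(μ[g|G]) ω‖ ≤ C := ae_bdd_abs_condExp_of_ae_bdd_abs (.of_forall hC)
  calc μ[f * g|G]
    _ =ᵐ[μ] μ[μ[f * g|A ⊔ G]|G] := (condExp_condExp_of_le le_sup_right (sup_le hA hG)).symm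
    _ =ᵐ[μ] μ[f * μ[g|G]|G] := condExp_congr_ae <|
        (condExp_mul_of_stronglyMeasurable_left (hf.mono le_sup_left) hfg hgi).trans
          ((h g hg hgi).mono fun ω hω => by simp [hω])
    _ =ᵐ[μ] μ[f|G] * μ[g|G] := condExp_mul_of_stronglyMeasurable_right stronglyMeasurable_condExp
        (hfi.mul_bdd integrable_condExp.aestronglyMeasurable hCq) hfi

end CondIndepGiven

lemma condExp_prod_ae_eq_prod_condExp [IsProbabilityMeasure μ] {ι : Type*}
    {A B : ι → MeasurableSpace Ω} {G : MeasurableSpace Ω} (hA : ∀ i, A i ≤ mΩ)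
    (hB : ∀ i, B i ≤ mΩ) (hG : G ≤ mΩ) (hAB : ∀ i j, j ≠ i → A j ≤ B i)
    (hind : ∀ i, CondIndepGiven μ (B i) (A i) G) {f : ι → Ω → ℝ} {C : ℝ}
    (hf : ∀ i, StronglyMeasurable[A i] (f i)) (hC : ∀ i ω, |f i ω| ≤ C) (s : Finset ι) :
    μ[∏ i ∈ s, f i|G] =ᵐ[μ] ∏ i ∈ s, μ[f i|G] := by
  classical
  have hfi : ∀ i, Integrable (f i) μ := fun i =>
    .of_bound ((hf i).mono (hA i)).aestronglyMeasurable C (.of_forall (hC i))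
  induction s using Finset.induction_on with
  | empty => simp [condExp_of_stronglyMeasurable hG stronglyMeasurable_one (integrable_const _)]
  | insert i s hi ih =>
    have hprod : StronglyMeasurable[B i] (∏ j ∈ s, f j) :=
      Finset.stronglyMeasurable_prod s fun j hj =>
        (hf j).mono (hAB i j (ne_of_mem_of_not_mem hj hi))
    have hprodi : Integrable (∏ j ∈ s, f j) μ :=
      .of_bound (hprod.mono (hB i)).aestronglyMeasurable (∏ _j ∈ s, C) <| .of_forall fun ω => by
        rw [Finset.prod_apply, Real.norm_eq_abs, Finset.abs_prod]
        exact Finset.prod_le_prod (fun _ _ => abs_nonneg _) fun j _ => hC j ω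
    rw [Finset.prod_insert hi, Finset.prod_insert hi, mul_comm, mul_comm (μ[f i|G])]
    exact ((hind i).condExp_mul (hB i) hG hprod hprodi (hf i) (hfi i) (hC i)).trans
      (ih.mul .rfl)

end ConditionalIndependence

noncomputable section

lemma Agent.adversaryOutput_eq_map {X : Type v} {Q M : Type u} {O : Type w} [MeasurableSpace Q]
    [MeasurableSpace M] [MeasurableSpace O] {P : Agent X Q M} {A : Interrogator Q M O} {S : Type*}
    [MeasurableSpace S] {ρ : Measure S} [SFinite ρ] {f : S → A.State} (hf : Measurable f)
    (hA : A.start = ρ.map f) (N : ℕ) (x : X) :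
    P.adversaryOutput A N x =
      (ρ.prod (P.start x)).map fun p => A.output ((P.exchange A)^[N] (f p.1, p.2)).1 := by
  have hprod : A.start.prod (P.start x) = (ρ.prod (P.start x)).map (Prod.map f id) := by
    rw [hA, ← Measure.map_prod_map _ _ hf measurable_id, Measure.map_id]
  rw [adversaryOutput, hprod]
  exact Measure.map_map (A.measurable_output.comp ((P.measurable_exchange A).iterate N).fst)
    (hf.prodMap measurable_id)

namespace LocalProtocol

section Privacy

variable {X : Type v} {Q M : Type u} {O : Type w}
  [MeasurableSpace Q] [MeasurableSpace M] [MeasurableSpace O] {n : ℕ}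
  (P : LocalProtocol X Q M O n) (i : Fin n)

lemma step_update_of_ne {c : P.Config} (hc : (P.referee.query c.1).1 ≠ i) (a : (P.agent i).State) :
    P.step (c.1, Function.update c.2 i a) =
      ((P.step c).1, Function.update (P.step c).2 i a) := by
  simp only [step, Function.update_of_ne hc, Function.update_comm hc]

lemma step_update_of_eq {c : P.Config} (hc : (P.referee.query c.1).1 = i) (a : (P.agent i).State) :
    P.step (c.1, Function.update c.2 i a) =
      (P.referee.receive (c.1, ((P.agent i).respond (a, (P.referee.query c.1).2)).1),
        Function.update c.2 i ((P.agent i).respond (a, (P.referee.query c.1).2)).2) := by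
  subst hc
  simp [step]

/-- Run the protocol until agent `i` is to be asked, or the number of remaining steps drops from
`m` to `0`; the result consists of the number of remaining steps and the configuration. Before
agent `i` is asked, its state does not matter, so that an adversary against that agent can do this
on its own. -/
def skip : ℕ → P.Config → ℕ × P.Config
  | 0, c => (0, c)
  | m + 1, c => if (P.referee.query c.1).1 = i then (m + 1, c) else skip m (P.step c)

lemma measurable_skip : Measurable fun z : ℕ × P.Config => P.skip i z.1 z.2 := by
  refine measurable_from_prod_countable_right fun m => ?_
  induction m with
  | zero => exact measurable_prodMk_left
  | succ m ih =>
    exact .ite ((P.referee.measurable_query.comp measurable_fst).fst (measurableSet_singleton i))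
      measurable_prodMk_left (ih.comp P.measurable_step)

lemma skip_fst_le (m : ℕ) (c : P.Config) : (P.skip i m c).1 ≤ m := by
  induction m generalizing c with
  | zero => exact le_rfl
  | succ m ih =>
    rw [skip]
    split_ifs
    exacts [le_rfl, (ih _).trans m.le_succ]

lemma query_skip_fst {m : ℕ} {c : P.Config} (h : (P.skip i m c).1 ≠ 0) :
    (P.referee.query (P.skip i m c).2.1).1 = i := by
  induction m generalizing c with
  | zero => exact absurd rfl h
  | succ m ih =>
    rw [skip] at h ⊢
    split_ifs at h ⊢ with hi
    exacts [hi, ih h]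

/-- The state of the referee when the `z.1` remaining steps are over, if agent `i` is now in
state `a`. -/
def finalReferee (z : ℕ × P.Config) (a : (P.agent i).State) : P.referee.State :=
  (P.step^[z.1] (z.2.1, Function.update z.2.2 i a)).1

lemma finalReferee_skip (m : ℕ) (c : P.Config) (a : (P.agent i).State) :
    P.finalReferee i (P.skip i m c) a = P.finalReferee i (m, c) a := by
  induction m generalizing c with
  | zero => rfl
  | succ m ih =>
    rw [skip]
    split_ifs with hi
    · rfl
    · rw [ih, finalReferee, finalReferee, Function.iterate_succ_apply, P.step_update_of_ne i hi]

/-- The adversary against agent `i` that plays the referee and all other agents for `N` steps,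
starting from a random configuration with law `ρ`. The state of agent `i` in its configuration is a
dummy. -/
def othersAdversary (N : ℕ) (ρ : Measure P.Config) [IsProbabilityMeasure ρ] :
    Interrogator Q M P.referee.State where
  State := ℕ × P.Config
  start := ρ.map (Prod.mk N)
  isProbabilityMeasure := Measure.isProbabilityMeasure_map measurable_prodMk_left.aemeasurable
  query z := (P.referee.query (P.skip i z.1 z.2).2.1).2
  measurable_query := (P.referee.measurable_query.comp (P.measurable_skip i).snd.fst).snd
  receive p := if (P.skip i p.1.1 p.1.2).1 = 0 then P.skip i p.1.1 p.1.2 else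
    ((P.skip i p.1.1 p.1.2).1 - 1,
      (P.referee.receive ((P.skip i p.1.1 p.1.2).2.1, p.2), (P.skip i p.1.1 p.1.2).2.2))
  measurable_receive := by
    have h : Measurable fun p : (ℕ × P.Config) × M => P.skip i p.1.1 p.1.2 :=
      (P.measurable_skip i).comp measurable_fst
    exact .ite (h.fst (measurableSet_singleton 0)) h <|
      ((Measurable.of_discrete (f := fun m : ℕ => m - 1)).comp h.fst).prodMk <|
        (P.referee.measurable_receive.comp (h.snd.fst.prodMk measurable_snd)).prodMk h.snd.snd
  output z := z.2.1
  measurable_output := measurable_snd.fst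

variable {N : ℕ} {ρ : Measure P.Config} [IsProbabilityMeasure ρ]

lemma exchange_othersAdversary (z : ℕ × P.Config) (a : (P.agent i).State) :
    ((P.agent i).exchange (P.othersAdversary i N ρ) (z, a)).1.1 ≤ z.1 - 1 ∧
      P.finalReferee i ((P.agent i).exchange (P.othersAdversary i N ρ) (z, a)).1
        ((P.agent i).exchange (P.othersAdversary i N ρ) (z, a)).2 = P.finalReferee i z a := by
  have hle := P.skip_fst_le i z.1 z.2
  have hask := P.query_skip_fst i (m := z.1) (c := z.2)
  have hfinal := P.finalReferee_skip i z.1 z.2 a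
  simp only [Agent.exchange, othersAdversary]
  rw [← show P.finalReferee i (P.skip i z.1 z.2) a = P.finalReferee i z a from hfinal]
  generalize P.skip i z.1 z.2 = z' at hle hask ⊢
  obtain ⟨m, c⟩ := z'
  cases m with
  | zero => exact ⟨Nat.zero_le _, rfl⟩
  | succ m =>
    simp only [Nat.add_one_ne_zero, if_false, finalReferee, Nat.add_sub_cancel,
      Function.iterate_succ_apply, P.step_update_of_eq i (hask (Nat.succ_ne_zero m)), and_true]
    exact Nat.sub_le_sub_right hle 1

lemma iterate_exchange_othersAdversary {k : ℕ} {z : ℕ × P.Config} (hk : z.1 ≤ k)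
    (a : (P.agent i).State) :
    (((P.agent i).exchange (P.othersAdversary i N ρ))^[k] (z, a)).1.2.1 =
      P.finalReferee i z a := by
  induction k generalizing z a with
  | zero => simp [finalReferee, Nat.le_zero.1 hk]
  | succ k ih =>
    obtain ⟨hle, hfinal⟩ := P.exchange_othersAdversary i (N := N) (ρ := ρ) z a
    rw [Function.iterate_succ_apply, ← hfinal]
    exact ih (hle.trans (by omega)) _

variable {P}

lemma IsDP.dpClose_referee {ε δ : ℝ} (h : P.IsDP ε δ) (N : ℕ) {S : Type*} [MeasurableSpace S]
    (ρ : Measure S) [IsProbabilityMeasure ρ] {c : S → P.Config} (hc : Measurable c) (x x' : X) :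
    DPClose ε δ
      ((ρ.prod ((P.agent i).start x)).map
        fun p => (P.step^[N] ((c p.1).1, Function.update (c p.1).2 i p.2)).1)
      ((ρ.prod ((P.agent i).start x')).map
        fun p => (P.step^[N] ((c p.1).1, Function.update (c p.1).2 i p.2)).1) := by
  have : IsProbabilityMeasure (ρ.map c) := Measure.isProbabilityMeasure_map hc.aemeasurable
  have hout : ∀ x, (P.agent i).adversaryOutput (P.othersAdversary i N (ρ.map c)) N x =
      (ρ.prod ((P.agent i).start x)).map
        fun p => (P.step^[N] ((c p.1).1, Function.update (c p.1).2 i p.2)).1 := fun x => by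
    rw [Agent.adversaryOutput_eq_map (A := P.othersAdversary i N (ρ.map c)) (ρ := ρ)
      (f := fun s => (N, c s)) (measurable_prodMk_left.comp hc)
      (Measure.map_map measurable_prodMk_left hc)]
    congr 1 with p
    exact P.iterate_exchange_othersAdversary i (z := (N, c p.1)) le_rfl p.2
  simpa only [hout] using h i P.referee.State (P.othersAdversary i N (ρ.map c)) N x x'

/-- Put a term in front of a sequence. -/
def consSeq {R : Type*} (a : R) (h : ℕ → R) : ℕ → R
  | 0 => a
  | l + 1 => h l

lemma measurable_consSeq {R : Type*} [MeasurableSpace R] :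
    Measurable fun p : R × (ℕ → R) => consSeq p.1 p.2 := by
  refine measurable_pi_lambda _ fun l => ?_
  cases l with
  | zero => exact measurable_fst
  | succ l => exact (measurable_pi_apply l).comp measurable_snd

lemma comap_consSeq {Ω R : Type*} [mR : MeasurableSpace R] (f : Ω → R) (g : Ω → ℕ → R) :
    MeasurableSpace.comap (fun ω => consSeq (f ω) (g ω)) inferInstance =
      mR.comap f ⊔ MeasurableSpace.comap g inferInstance := by
  refine le_antisymm (Measurable.comap_le ?_) (sup_le ?_ ?_)
  · exact measurable_consSeq.comp (((comap_measurable f).mono le_sup_left le_rfl).prodMk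
      ((comap_measurable g).mono le_sup_right le_rfl))
  · exact MeasurableSpace.comap_le_comap_of_eq_comp (fun h => h 0) (measurable_pi_apply 0) rfl
  · exact MeasurableSpace.comap_le_comap_of_eq_comp (fun h l => h (l + 1))
      (measurable_pi_lambda _ fun l => measurable_pi_apply (l + 1)) rfl

variable (P)

/-- The states of the referee during the first `t` steps, in reverse order of time, so that a new
state is put in front. Sequences are used to have one type for all `t`; after `t + 1` terms they
repeat the initial state. -/
def history (t : ℕ) (c : P.Config) : ℕ → P.referee.State :=
  fun l => (P.step^[t - l] c).1

lemma measurable_history (t : ℕ) : Measurable (P.history t) :=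
  measurable_pi_lambda _ fun l => (P.measurable_step.iterate (t - l)).fst

lemma history_succ (t : ℕ) (c : P.Config) :
    P.history (t + 1) c = consSeq (P.step^[t + 1] c).1 (P.history t c) := by
  funext l
  cases l with
  | zero => rfl
  | succ l => simp [history, consSeq]

/-- The protocol with a referee that remembers its past states, started in a configuration where
the referee has the law of the one of `P`, and outputs them in the end. -/
def record : LocalProtocol X Q M (ℕ → P.referee.State) n where
  agent := P.agent
  referee :=
    { State := ℕ → P.referee.State
      start := P.referee.start.map fun σ _ => σ
      isProbabilityMeasure := Measure.isProbabilityMeasure_map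
        (measurable_pi_lambda _ fun _ => measurable_id).aemeasurable
      query := fun h => P.referee.query (h 0)
      measurable_query := P.referee.measurable_query.comp (measurable_pi_apply 0)
      receive := fun p => consSeq (P.referee.receive (p.1 0, p.2)) p.1
      measurable_receive := measurable_consSeq.comp <|
        (P.referee.measurable_receive.comp
          (((measurable_pi_apply 0).comp measurable_fst).prodMk measurable_snd)).prodMk
          measurable_fst
      output := id
      measurable_output := measurable_id }
  messages := P.messages

lemma iterate_step_record (t : ℕ) (c : P.Config) :
    P.record.step^[t] (fun _ => c.1, c.2) = (P.history t c, (P.step^[t] c).2) := by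
  induction t with
  | zero => exact Prod.ext (funext fun l => by simp [history]) rfl
  | succ t ih =>
    rw [Function.iterate_succ_apply', ih, history_succ, Function.iterate_succ_apply']
    rfl

variable {P}

lemma IsDP.dpClose_history {ε δ : ℝ} (h : P.IsDP ε δ) (N : ℕ) {S : Type*} [MeasurableSpace S]
    (ρ : Measure S) [IsProbabilityMeasure ρ] {c : S → P.Config} (hc : Measurable c) (x x' : X) :
    DPClose ε δ
      ((ρ.prod ((P.agent i).start x)).map
        fun p => P.history N ((c p.1).1, Function.update (c p.1).2 i p.2))
      ((ρ.prod ((P.agent i).start x')).map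
        fun p => P.history N ((c p.1).1, Function.update (c p.1).2 i p.2)) := by
  have hrec : P.record.IsDP ε δ := h
  have hc' : Measurable fun s => (show P.record.Config from (fun _ => (c s).1, (c s).2)) :=
    (measurable_pi_lambda _ fun _ => hc.fst).prodMk hc.snd
  have hstep : ∀ p : S × (P.agent i).State,
      (P.record.step^[N] (fun _ => (c p.1).1, Function.update (c p.1).2 i p.2)).1 =
        P.history N ((c p.1).1, Function.update (c p.1).2 i p.2) := fun p =>
    congrArg Prod.fst (P.iterate_step_record N ((c p.1).1, Function.update (c p.1).2 i p.2))
  have hclose := hrec.dpClose_referee i N ρ hc' x x'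
  simp only [← hstep]
  exact hclose

variable (P)

/-- The histories of length `t` in which agent `i` is asked; the query answered in the step to the
state with index `l` is the one of the state with index `l + 1`. -/
def askedHistories (t : ℕ) : Set (ℕ → P.referee.State) :=
  {h | ∃ l ∈ Finset.Icc 1 t, (P.referee.query (h l)).1 = i}

lemma measurableSet_askedHistories (t : ℕ) : MeasurableSet (P.askedHistories i t) := by
  have hunion : P.askedHistories i t =
      ⋃ l ∈ Finset.Icc 1 t, {h | (P.referee.query (h l)).1 = i} := by
    ext h
    simp [askedHistories]
  rw [hunion]
  exact Finset.measurableSet_biUnion _ fun l _ =>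
    (P.referee.measurable_query.comp (measurable_pi_apply l)).fst (measurableSet_singleton i)

lemma sum_indicator_askedHistories_le (t : ℕ) (h : ℕ → P.referee.State) :
    ∑ i, (P.askedHistories i t).indicator (1 : (ℕ → P.referee.State) → ℝ) h ≤ t := by
  classical
  have hsub : (Finset.univ.filter fun i => h ∈ P.askedHistories i t) ⊆
      (Finset.Icc 1 t).image fun l => (P.referee.query (h l)).1 := by
    intro i hi
    obtain ⟨l, hl, rfl⟩ := (Finset.mem_filter.1 hi).2
    exact Finset.mem_image_of_mem _ hl
  have hcard := (Finset.card_le_card hsub).trans Finset.card_image_le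
  simp only [Set.indicator_apply, Pi.one_apply, Finset.sum_boole]
  exact_mod_cast hcard.trans_eq (by simp)

variable {P i}

lemma history_update_of_not_asked {t : ℕ} {c : P.Config}
    (hc : P.history t c ∉ P.askedHistories i t) (a : (P.agent i).State) :
    P.history t (c.1, Function.update c.2 i a) = P.history t c := by
  have hstep : ∀ l ≤ t, P.step^[l] (c.1, Function.update c.2 i a) =
      ((P.step^[l] c).1, Function.update (P.step^[l] c).2 i a) := by
    intro l hl
    induction l with
    | zero => rfl
    | succ l ih =>
      rw [Function.iterate_succ_apply', ih (by omega), Function.iterate_succ_apply']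
      refine P.step_update_of_ne i (fun hq => hc ⟨t - l, ?_, ?_⟩) a
      · exact Finset.mem_Icc.2 (by omega)
      · rwa [history, show t - (t - l) = l by omega]
  funext l
  simp only [history, hstep (t - l) (Nat.sub_le _ _)]

lemma history_update_mem_askedHistories {t : ℕ} {c : P.Config} (a : (P.agent i).State) :
    P.history t (c.1, Function.update c.2 i a) ∈ P.askedHistories i t ↔
      P.history t c ∈ P.askedHistories i t := by
  rw [← not_iff_not]
  constructor
  · intro h
    have hback := history_update_of_not_asked h (c.2 i)
    simp only [Function.update_idem, Function.update_eq_self] at hback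
    rwa [← hback] at h
  · intro h
    rwa [history_update_of_not_asked h]

end Privacy

end LocalProtocol

section ProductMeasures

lemma lintegral_pi_prod {ι : Type*} [Fintype ι] {α : ι → Type*} [∀ i, MeasurableSpace (α i)]
    (μ : ∀ i, Measure (α i)) [∀ i, IsProbabilityMeasure (μ i)] {f : ∀ i, α i → ℝ≥0∞}
    (hf : ∀ i, Measurable (f i)) :
    ∫⁻ ω, ∏ i, f i (ω i) ∂Measure.pi μ = ∏ i, ∫⁻ a, f i a ∂μ i := by
  refine (lintegral_prod_eq_prod_lintegral_of_indepFun Finset.univ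
    (fun i (ω : ∀ i, α i) => f i (ω i)) (iIndepFun_pi fun i => (hf i).aemeasurable) fun i =>
      (hf i).comp (measurable_pi_apply i)).trans ?_
  exact Finset.prod_congr rfl fun i _ => (measurePreserving_eval μ i).lintegral_comp (hf i)

lemma pi_withDensity {ι : Type*} [Fintype ι] {α : ι → Type*} [∀ i, MeasurableSpace (α i)]
    (μ : ∀ i, Measure (α i)) [∀ i, IsProbabilityMeasure (μ i)] {f : ∀ i, α i → ℝ≥0∞}
    (hf : ∀ i, Measurable (f i)) [∀ i, SigmaFinite ((μ i).withDensity (f i))] :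
    Measure.pi (fun i => (μ i).withDensity (f i)) =
      (Measure.pi μ).withDensity fun ω => ∏ i, f i (ω i) := by
  refine Measure.pi_eq fun s hs => ?_
  have hind : ∀ ω, (Set.univ.pi s).indicator (fun ω => ∏ i, f i (ω i)) ω =
      ∏ i, (s i).indicator (f i) (ω i) := fun ω => by
    classical
    by_cases hω : ω ∈ Set.univ.pi s
    · rw [Set.indicator_of_mem hω]
      exact Finset.prod_congr rfl fun i _ => (Set.indicator_of_mem (hω i trivial) _).symm
    · obtain ⟨i, hi⟩ : ∃ i, ω i ∉ s i := by simpa [Set.mem_univ_pi] using hω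
      rw [Set.indicator_of_notMem hω, Finset.prod_eq_zero (Finset.mem_univ i)
        (Set.indicator_of_notMem hi _)]
  rw [withDensity_apply _ (.univ_pi hs), ← lintegral_indicator (.univ_pi hs),
    lintegral_congr hind, lintegral_pi_prod μ fun i => (hf i).indicator (hs i)]
  exact Finset.prod_congr rfl fun i _ => by
    rw [lintegral_indicator (hs i), withDensity_apply _ (hs i)]

lemma measurePreserving_update {ι : Type*} [Fintype ι] [DecidableEq ι] {α : ι → Type*}
    [∀ i, MeasurableSpace (α i)] (μ : ∀ i, Measure (α i)) [∀ i, IsProbabilityMeasure (μ i)]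
    (i : ι) :
    MeasurePreserving (fun p : (∀ j, α j) × α i => Function.update p.1 i p.2)
      ((Measure.pi μ).prod (μ i)) (Measure.pi μ) := by
  refine ⟨measurable_update', (Measure.pi_eq fun s hs => ?_).symm⟩
  have hpre : (fun p : (∀ j, α j) × α i => Function.update p.1 i p.2) ⁻¹' Set.univ.pi s =
      Set.univ.pi (Function.update s i Set.univ) ×ˢ s i := by
    ext ⟨ω, a⟩
    simp only [Set.mem_preimage, Set.mem_prod, Set.mem_univ_pi]
    refine ⟨fun h => ⟨fun j => ?_, by simpa using h i⟩, fun h j => ?_⟩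
    · obtain rfl | hj := eq_or_ne j i
      · simp
      · simpa [hj] using h j
    · obtain rfl | hj := eq_or_ne j i
      · simpa using h.2
      · simpa [hj] using h.1 j
  rw [Measure.map_apply measurable_update' (.univ_pi hs), hpre, Measure.prod_prod, Measure.pi_pi,
    ← Finset.prod_erase_mul _ _ (Finset.mem_univ i),
    ← Finset.prod_erase_mul _ (fun j => μ j (s j)) (Finset.mem_univ i)]
  simp only [Function.update_self, measure_univ, mul_one]
  congr 1
  exact Finset.prod_congr rfl fun j hj => by rw [Function.update_of_ne (Finset.ne_of_mem_erase hj)]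

lemma measurePreserving_update_snd {S : Type*} [MeasurableSpace S] (ρ : Measure S) [SFinite ρ]
    {ι : Type*} [Fintype ι] [DecidableEq ι] {α : ι → Type*} [∀ i, MeasurableSpace (α i)]
    (μ : ∀ i, Measure (α i)) [∀ i, IsProbabilityMeasure (μ i)] (i : ι) :
    MeasurePreserving
      (fun p : (S × ∀ j, α j) × α i => (p.1.1, Function.update p.1.2 i p.2))
      ((ρ.prod (Measure.pi μ)).prod (μ i)) (ρ.prod (Measure.pi μ)) :=
  ((MeasurePreserving.id ρ).prod (measurePreserving_update μ i)).comp
    (measurePreserving_prodAssoc ρ (Measure.pi μ) (μ i))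

lemma indepFun_eval_of_update_invariant {S : Type*} [MeasurableSpace S] (ρ : Measure S)
    [IsProbabilityMeasure ρ] {ι : Type*} [Fintype ι] [DecidableEq ι] {α : ι → Type*}
    [∀ i, MeasurableSpace (α i)] (μ : ∀ i, Measure (α i)) [∀ i, IsProbabilityMeasure (μ i)] {i : ι}
    {β : Type*} [MeasurableSpace β] {f : (S × ∀ j, α j) → β} (hf : Measurable f)
    (hfi : ∀ ω a, f (ω.1, Function.update ω.2 i a) = f ω) :
    IndepFun (fun ω : S × ∀ j, α j => ω.2 i) f (ρ.prod (Measure.pi μ)) := by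
  have hi : Measurable fun ω : S × ∀ j, α j => ω.2 i := (measurable_pi_apply i).comp measurable_snd
  have heval : (ρ.prod (Measure.pi μ)).map (fun ω => ω.2 i) = μ i :=
    ((measurePreserving_eval μ i).comp measurePreserving_snd).map_eq
  rw [indepFun_iff_map_prod_eq_prod_map_map hi.aemeasurable hf.aemeasurable, heval]
  have hcomp : (fun ω : S × ∀ j, α j => (ω.2 i, f ω)) ∘
      (fun p : (S × ∀ j, α j) × α i => (p.1.1, Function.update p.1.2 i p.2)) =
        Prod.swap ∘ Prod.map f id := by
    ext p <;> simp [hfi]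
  conv_lhs => rw [← (measurePreserving_update_snd ρ μ i).map_eq]
  rw [Measure.map_map (hi.prodMk hf) (measurePreserving_update_snd ρ μ i).measurable, hcomp,
    ← Measure.map_map measurable_swap (hf.prodMap measurable_id),
    ← Measure.map_prod_map _ _ hf measurable_id, Measure.map_id, Measure.prod_swap]

lemma withDensity_compProd_left {α β : Type*} [MeasurableSpace α] [MeasurableSpace β]
    (ν : Measure α) [SFinite ν] (κ : Kernel α β) [IsSFiniteKernel κ] {g : α → ℝ≥0∞}
    (hg : Measurable g) [SFinite (ν.withDensity g)] :
    ν.withDensity g ⊗ₘ κ = (ν ⊗ₘ κ).withDensity fun p => g p.1 := by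
  ext s hs
  rw [Measure.compProd_apply hs, withDensity_apply _ hs, ← lintegral_indicator hs,
    Measure.lintegral_compProd (f := s.indicator fun p => g p.1)
      (.indicator (hg.comp measurable_fst) hs),
    lintegral_withDensity_eq_lintegral_mul _ hg (Kernel.measurable_kernel_prodMk_left hs)]
  refine lintegral_congr fun a => ?_
  have hind : ∀ b, s.indicator (fun p => g p.1) (a, b) =
      (Prod.mk a ⁻¹' s).indicator (fun _ => g a) b := fun b => rfl
  simp only [hind, lintegral_indicator_const (measurable_prodMk_left hs), Pi.mul_apply]

lemma prod_bind {α β γ : Type*} [MeasurableSpace α] [MeasurableSpace β] [MeasurableSpace γ]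
    (ρ : Measure γ) [SFinite ρ] (ν : Measure α) [SFinite ν] (κ : Kernel α β) [IsSFiniteKernel κ] :
    ρ.prod (ν.bind κ) = ν.bind fun a => ρ.prod (κ a) := by
  have hκ : Measurable fun a => ρ.prod (κ a) := by
    convert (Kernel.const α ρ ×ₖ κ).measurable using 2 with a
    rw [Kernel.prod_apply, Kernel.const_apply]
  ext s hs
  rw [Measure.prod_apply_symm hs, Measure.bind_apply hs hκ.aemeasurable,
    Measure.lintegral_bind κ.aemeasurable (measurable_measure_prodMk_right hs).aemeasurable]
  exact lintegral_congr fun a => (Measure.prod_apply_symm hs).symm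

lemma measurable_pi_kernel {ι : Type*} [Fintype ι] {α β : ι → Type*}
    [∀ i, MeasurableSpace (α i)] [∀ i, MeasurableSpace (β i)] (κ : ∀ i, Kernel (α i) (β i))
    [∀ i, IsMarkovKernel (κ i)] :
    Measurable fun a : ∀ i, α i => Measure.pi fun i => κ i (a i) := by
  refine .measure_of_isPiSystem_of_isProbabilityMeasure generateFrom_pi.symm isPiSystem_pi ?_
  rintro _ ⟨s, hs, rfl⟩
  simp only [Measure.pi_pi]
  exact Finset.measurable_prod _ fun i _ =>
    ((κ i).measurable_coe (hs i trivial)).comp (measurable_pi_apply i)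

lemma pi_bind {ι : Type*} [Fintype ι] {α β : ι → Type*} [∀ i, MeasurableSpace (α i)]
    [∀ i, MeasurableSpace (β i)] (ν : ∀ i, Measure (α i)) [∀ i, IsProbabilityMeasure (ν i)]
    (κ : ∀ i, Kernel (α i) (β i)) [∀ i, IsMarkovKernel (κ i)] :
    Measure.pi (fun i => (ν i).bind (κ i)) =
      (Measure.pi ν).bind fun a => Measure.pi fun i => κ i (a i) := by
  refine Measure.pi_eq fun s hs => ?_
  rw [Measure.bind_apply (.univ_pi hs) (measurable_pi_kernel κ).aemeasurable]
  simp only [Measure.pi_pi]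
  rw [lintegral_pi_prod ν fun i => (κ i).measurable_coe (hs i)]
  exact Finset.prod_congr rfl fun i _ =>
    (Measure.bind_apply (hs i) (κ i).aemeasurable).symm

lemma compProd_le_of_dpClose {X H : Type*} [MeasurableSpace X] [MeasurableSpace H] {ε : ℝ}
    (ν : Measure X) [IsProbabilityMeasure ν] (K : Kernel X H) [IsMarkovKernel K]
    (hK : ∀ x x', DPClose ε 0 (K x) (K x')) :
    ν ⊗ₘ K ≤ ENNReal.ofReal (Real.exp ε) • ν.prod (ν.bind K) := by
  refine Measure.le_intro fun s hs _ => ?_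
  rw [Measure.compProd_apply hs, Measure.smul_apply, smul_eq_mul, Measure.prod_apply hs,
    ← lintegral_const_mul _ (measurable_measure_prodMk_left hs)]
  refine lintegral_mono fun x => ?_
  have hx : MeasurableSet (Prod.mk x ⁻¹' s) := measurable_prodMk_left hs
  rw [Measure.bind_apply hx K.aemeasurable, ← lintegral_const_mul _ (K.measurable_coe hx)]
  calc K x (Prod.mk x ⁻¹' s) = ∫⁻ _, K x (Prod.mk x ⁻¹' s) ∂ν := by simp
    _ ≤ _ := lintegral_mono fun x' => by simpa using (hK x x' _ hx).1

end ProductMeasures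

section Decoupling

variable {κ X : Type*} [Fintype κ] [MeasurableSpace X] {ν : Measure X} [IsProbabilityMeasure ν]
  {φ : κ → X → ℝ}

lemma integral_sq_sum_le_card (hφ : ∀ k, Measurable (φ k)) (hbdd : ∀ k x, |φ k x| ≤ 1)
    (horth : Pairwise fun k l => ∫ x, φ k x * φ l x ∂ν = 0) {c : κ → ℝ} (hc : ∀ k, |c k| ≤ 1) :
    ∫ x, (∑ k, c k * φ k x) ^ 2 ∂ν ≤ Fintype.card κ := by
  have hfint : ∀ k l, Integrable (fun x => φ k x * φ l x) ν := fun k l =>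
    .of_bound ((hφ k).mul (hφ l)).aestronglyMeasurable 1 <| .of_forall fun x => by
      rw [norm_mul]
      exact mul_le_one₀ (hbdd k x) (norm_nonneg _) (hbdd l x)
  have hsq : ∀ x, (∑ k, c k * φ k x) ^ 2 = ∑ k, ∑ l, c k * c l * (φ k x * φ l x) := fun x => by
    rw [sq, Finset.sum_mul_sum]
    exact Finset.sum_congr rfl fun k _ => Finset.sum_congr rfl fun l _ => by ring
  calc ∫ x, (∑ k, c k * φ k x) ^ 2 ∂ν = ∑ k, ∑ l, c k * c l * ∫ x, φ k x * φ l x ∂ν := by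
        simp only [hsq]
        rw [integral_finsetSum _ fun k _ => integrable_finsetSum _ fun l _ =>
          (hfint k l).const_mul _]
        refine Finset.sum_congr rfl fun k _ => ?_
        rw [integral_finsetSum _ fun l _ => (hfint k l).const_mul _]
        exact Finset.sum_congr rfl fun l _ => integral_const_mul _ _
    _ = ∑ k, c k * c k * ∫ x, φ k x * φ k x ∂ν := Finset.sum_congr rfl fun k _ =>
        Finset.sum_eq_single k (fun l _ hl => by rw [horth hl.symm, mul_zero]) (by simp)
    _ ≤ ∑ _k : κ, 1 := Finset.sum_le_sum fun k _ => by
        have hk : ∫ x, φ k x * φ k x ∂ν ≤ 1 := by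
          refine (integral_mono (hfint k k) (integrable_const 1) fun x => ?_).trans_eq (by simp)
          exact (abs_le_one_iff_mul_self_le_one).1 (hbdd k x)
        exact mul_le_one₀ (abs_le_one_iff_mul_self_le_one.1 (hc k))
          (integral_nonneg fun x => mul_self_nonneg _) hk
    _ = Fintype.card κ := by simp

lemma integral_abs_sum_le_sqrt_card (hφ : ∀ k, Measurable (φ k)) (hbdd : ∀ k x, |φ k x| ≤ 1)
    (horth : Pairwise fun k l => ∫ x, φ k x * φ l x ∂ν = 0) {c : κ → ℝ} (hc : ∀ k, |c k| ≤ 1) :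
    ∫ x, |∑ k, c k * φ k x| ∂ν ≤ √(Fintype.card κ) := by
  have hmem : MemLp (fun x => |∑ k, c k * φ k x|) 2 ν :=
    (memLp_finsetSum Finset.univ fun k _ => (MemLp.of_bound (hφ k).aestronglyMeasurable 1
      (.of_forall (hbdd k))).const_mul (c k)).abs
  have hvar := variance_eq_sub hmem ▸ variance_nonneg (fun x => |∑ k, c k * φ k x|) ν
  refine Real.le_sqrt_of_sq_le ?_
  refine le_trans ?_ (integral_sq_sum_le_card hφ hbdd horth hc)
  simpa [sq_abs] using hvar

variable {Ω H : Type*} {mΩ : MeasurableSpace Ω} {μ : Measure Ω} [IsProbabilityMeasure μ]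
  [mH : MeasurableSpace H] {x : Ω → X} {h : Ω → H}

lemma exists_setIntegral_abs_condExp_eq (hh : Measurable h) {f : Ω → ℝ} (hf : Integrable f μ)
    {A : Set H} (hA : MeasurableSet A) :
    ∃ c : H → ℝ, Measurable c ∧ (∀ y, |c y| ≤ 1) ∧
      ∫ ω in h ⁻¹' A, |(μ[f|mH.comap h]) ω| ∂μ = ∫ ω in h ⁻¹' A, f ω * c (h ω) ∂μ := by
  obtain ⟨b, hb, hbh⟩ := (stronglyMeasurable_condExp (f := f) (μ := μ)
    (m := mH.comap h)).measurable.exists_eq_measurable_comp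
  let c : H → ℝ := fun y => if 0 ≤ b y then 1 else -1
  have hc : Measurable c := .ite (measurableSet_le measurable_const hb) measurable_const
    measurable_const
  have hc1 : ∀ y, |c y| ≤ 1 := fun y => by
    by_cases hy : 0 ≤ b y <;> simp [c, hy]
  have habs : ∀ y, |b y| = b y * c y := fun y => by
    by_cases hy : 0 ≤ b y
    · simp [c, hy, abs_of_nonneg hy]
    · simp [c, hy, abs_of_neg (not_le.1 hy)]
  refine ⟨c, hc, hc1, ?_⟩
  have hcA : StronglyMeasurable[mH.comap h] fun ω => A.indicator c (h ω) :=
    ((hc.indicator hA).comp (comap_measurable h)).stronglyMeasurable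
  rw [← integral_indicator (hh hA), ← integral_indicator (hh hA)]
  calc ∫ ω, (h ⁻¹' A).indicator (fun ω => |(μ[f|mH.comap h]) ω|) ω ∂μ
    _ = ∫ ω, (μ[f|mH.comap h]) ω * A.indicator c (h ω) ∂μ := by
        refine integral_congr_ae (.of_forall fun ω => ?_)
        by_cases hω : h ω ∈ A <;> simp [hω, hbh, habs]
    _ = ∫ ω, f ω * A.indicator c (h ω) ∂μ :=
        (integral_mul_eq_integral_condExp_mul hh.comap_le hf hcA <|
          hf.mul_bdd (hcA.mono hh.comap_le).aestronglyMeasurable (c := 1)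
            (.of_forall fun ω => (norm_indicator_le_norm_self _ _).trans (hc1 _))).symm
    _ = ∫ ω, (h ⁻¹' A).indicator (fun ω => f ω * c (h ω)) ω ∂μ := by
        refine integral_congr_ae (.of_forall fun ω => ?_)
        by_cases hω : h ω ∈ A <;> simp [hω]

lemma integral_indicator_abs_sum_le_of_map_le (hx : Measurable x) (hh : Measurable h)
    (hφ : ∀ k, Measurable (φ k)) (hbdd : ∀ k x, |φ k x| ≤ 1)
    (horth : Pairwise fun k l => ∫ x, φ k x * φ l x ∂ν = 0) {C : ℝ} (hC : 0 ≤ C)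
    (hjoint : μ.map (fun ω => (x ω, h ω)) ≤ ENNReal.ofReal C • ν.prod (μ.map h))
    {A : Set H} (hA : MeasurableSet A) {c : κ → H → ℝ} (hc : ∀ k, Measurable (c k))
    (hc1 : ∀ k y, |c k y| ≤ 1) :
    ∫ ω in h ⁻¹' A, |∑ k, c k (h ω) * φ k (x ω)| ∂μ ≤
      C * √(Fintype.card κ) * μ.real (h ⁻¹' A) := by
  have := Measure.isProbabilityMeasure_map (μ := μ) hh.aemeasurable
  let F : X × H → ℝ := fun p => A.indicator (fun y => |∑ k, c k y * φ k p.1|) p.2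
  have hF : Measurable F := by
    have : Measurable fun p : X × H => |∑ k, c k p.2 * φ k p.1| := by fun_prop
    exact this.indicator (measurable_snd hA)
  have hF0 : ∀ p, 0 ≤ F p := fun p => Set.indicator_nonneg (fun _ _ => abs_nonneg _) _
  have hFi : Integrable F (ν.prod (μ.map h)) := by
    refine .of_bound hF.aestronglyMeasurable (Fintype.card κ) (.of_forall fun p => ?_)
    refine (norm_indicator_le_norm_self _ _).trans ?_
    rw [norm_abs_eq_norm]
    calc ‖∑ k, c k p.2 * φ k p.1‖ ≤ ∑ k, ‖c k p.2 * φ k p.1‖ := norm_sum_le _ _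
      _ ≤ ∑ _k : κ, 1 := Finset.sum_le_sum fun k _ => by
          rw [norm_mul]
          exact mul_le_one₀ (hc1 k _) (norm_nonneg _) (hbdd k _)
      _ = Fintype.card κ := by simp
  calc ∫ ω in h ⁻¹' A, |∑ k, c k (h ω) * φ k (x ω)| ∂μ
    _ = ∫ p, F p ∂μ.map (fun ω => (x ω, h ω)) := by
        rw [integral_map (hx.prodMk hh).aemeasurable hF.aestronglyMeasurable,
          ← integral_indicator (hh hA)]
        rfl
    _ ≤ ∫ p, F p ∂(ENNReal.ofReal C • ν.prod (μ.map h)) :=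
        integral_mono_measure hjoint (.of_forall hF0) (hFi.smul_measure ENNReal.ofReal_ne_top)
    _ = C * ∫ y, ∫ x, F (x, y) ∂ν ∂μ.map h := by
        rw [integral_smul_measure, ENNReal.toReal_ofReal hC, smul_eq_mul,
          integral_prod_symm F hFi]
    _ ≤ C * ∫ y, A.indicator (fun _ => √(Fintype.card κ)) y ∂μ.map h := by
        refine mul_le_mul_of_nonneg_left (integral_mono hFi.integral_prod_right
          ((integrable_const _).indicator hA) fun y => ?_) hC
        by_cases hy : y ∈ A
        · simpa [F, hy] using integral_abs_sum_le_sqrt_card hφ hbdd horth fun k => hc1 k y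
        · simp [F, hy]
    _ = C * √(Fintype.card κ) * μ.real (h ⁻¹' A) := by
        rw [integral_indicator_const _ hA, map_measureReal_apply hh hA, smul_eq_mul]
        ring

lemma sum_setIntegral_abs_condExp_le (hx : Measurable x) (hh : Measurable h)
    (hφ : ∀ k, Measurable (φ k)) (hbdd : ∀ k x, |φ k x| ≤ 1)
    (horth : Pairwise fun k l => ∫ x, φ k x * φ l x ∂ν = 0) {C : ℝ} (hC : 0 ≤ C)
    (hjoint : μ.map (fun ω => (x ω, h ω)) ≤ ENNReal.ofReal C • ν.prod (μ.map h))
    {A : Set H} (hA : MeasurableSet A) :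
    ∑ k, ∫ ω in h ⁻¹' A, |(μ[fun ω => φ k (x ω)|mH.comap h]) ω| ∂μ ≤
      C * √(Fintype.card κ) * μ.real (h ⁻¹' A) := by
  have hφx : ∀ k, Integrable (fun ω => φ k (x ω)) μ := fun k =>
    .of_bound ((hφ k).comp hx).aestronglyMeasurable 1 (.of_forall fun ω => hbdd k _)
  choose c hc hc1 hcφ using fun k => exists_setIntegral_abs_condExp_eq hh (hφx k) hA
  have hfint : ∀ k, Integrable (fun ω => φ k (x ω) * c k (h ω)) μ := fun k =>
    (hφx k).mul_bdd ((hc k).comp hh).aestronglyMeasurable (.of_forall fun ω => hc1 k _)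
  calc ∑ k, ∫ ω in h ⁻¹' A, |(μ[fun ω => φ k (x ω)|mH.comap h]) ω| ∂μ
    _ = ∫ ω in h ⁻¹' A, ∑ k, φ k (x ω) * c k (h ω) ∂μ := by
        rw [integral_finsetSum _ fun k _ => (hfint k).integrableOn]
        exact Finset.sum_congr rfl fun k _ => hcφ k
    _ ≤ ∫ ω in h ⁻¹' A, |∑ k, c k (h ω) * φ k (x ω)| ∂μ := by
        simp only [mul_comm (c _ _)]
        have hsum := (integrable_finsetSum Finset.univ fun k _ => hfint k).integrableOn
          (s := h ⁻¹' A)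
        exact integral_mono hsum hsum.abs fun ω => le_abs_self _
    _ ≤ C * √(Fintype.card κ) * μ.real (h ⁻¹' A) :=
        integral_indicator_abs_sum_le_of_map_le hx hh hφ hbdd horth hC hjoint hA hc hc1

end Decoupling

lemma one_sub_sum_abs_le_prod_one_add {ι R : Type*} [CommRing R] [LinearOrder R]
    [IsStrictOrderedRing R] (s : Finset ι) {b : ι → R} (hb : ∀ i ∈ s, |b i| ≤ 1) :
    1 - ∑ i ∈ s, |b i| ≤ ∏ i ∈ s, (1 + b i) := by
  induction s using Finset.cons_induction with
  | empty => simp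
  | cons i s hi ih =>
    obtain ⟨hbi, hbs⟩ := Finset.forall_mem_cons hi _ |>.1 hb
    have hprod : 0 ≤ ∏ j ∈ s, (1 + b j) :=
      Finset.prod_nonneg fun j hj => by linarith [neg_le_of_abs_le (hbs j hj)]
    have hsum : 0 ≤ ∑ j ∈ s, |b j| := Finset.sum_nonneg fun j _ => abs_nonneg _
    rw [Finset.sum_cons, Finset.prod_cons]
    calc 1 - (|b i| + ∑ j ∈ s, |b j|) ≤ (1 - |b i|) * (1 - ∑ j ∈ s, |b j|) := by
          linarith [mul_nonneg (abs_nonneg (b i)) hsum]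
      _ ≤ (1 - |b i|) * ∏ j ∈ s, (1 + b j) :=
          mul_le_mul_of_nonneg_left (ih hbs) (sub_nonneg.2 hbi)
      _ ≤ (1 + b i) * ∏ j ∈ s, (1 + b j) :=
          mul_le_mul_of_nonneg_right (by linarith [neg_abs_le (b i)]) hprod

lemma integrable_of_forall_abs_le {X : Type*} [MeasurableSpace X] [Countable X]
    [MeasurableSingletonClass X] {ν : Measure X} [IsFiniteMeasure ν] {f : X → ℝ} {C : ℝ}
    (hC : ∀ x, |f x| ≤ C) : Integrable f ν :=
  .of_bound (measurable_of_countable f).aestronglyMeasurable C (.of_forall hC)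

section LinearTilt

variable {X : Type*} [MeasurableSpace X] {ν : Measure X} {f : X → ℝ}

/-- The measure with density `1 + f` with respect to `ν`, which is a perturbation of `ν` in the
direction `f`; it is meant for `-1 ≤ f`, as the density is truncated at `0`. -/
def linearTilt (ν : Measure X) (f : X → ℝ) : Measure X :=
  ν.withDensity fun x => ENNReal.ofReal (1 + f x)

lemma one_add_nonneg_of_abs_le_one {a : ℝ} (h : |a| ≤ 1) : 0 ≤ 1 + a := by
  linarith [neg_le_of_abs_le h]

lemma measureReal_withDensity_ofReal (hf : Integrable f ν) (h0 : ∀ x, 0 ≤ f x) {s : Set X}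
    (hs : MeasurableSet s) :
    (ν.withDensity fun x => ENNReal.ofReal (f x)).real s = ∫ x in s, f x ∂ν := by
  rw [measureReal_def, withDensity_apply _ hs,
    ← ofReal_integral_eq_lintegral_ofReal hf.integrableOn (.of_forall h0),
    ENNReal.toReal_ofReal (integral_nonneg h0)]

lemma linearTilt_real [IsFiniteMeasure ν] (hf : Integrable f ν) (hbdd : ∀ x, |f x| ≤ 1) {s : Set X}
    (hs : MeasurableSet s) : (linearTilt ν f).real s = ν.real s + ∫ x in s, f x ∂ν := by
  have hfint : Integrable (fun x => 1 + f x) ν := (integrable_const 1).add hf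
  rw [linearTilt, measureReal_withDensity_ofReal hfint
    (fun x => one_add_nonneg_of_abs_le_one (hbdd x)) hs,
    integral_add (integrable_const 1) hf.integrableOn]
  simp

lemma isProbabilityMeasure_linearTilt [IsProbabilityMeasure ν] (hf : Integrable f ν)
    (hbdd : ∀ x, |f x| ≤ 1) (hmean : ∫ x, f x ∂ν = 0) :
    IsProbabilityMeasure (linearTilt ν f) := by
  have hreal := linearTilt_real hf hbdd .univ
  rw [setIntegral_univ, hmean, add_zero, probReal_univ (μ := ν)] at hreal
  exact ⟨(ENNReal.toReal_eq_one_iff _).1 hreal⟩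

end LinearTilt

namespace LocalProtocol

section Information

variable {X : Type v} {Q M : Type u} {O : Type w} [MeasurableSpace Q] [MeasurableSpace M]
  [MeasurableSpace O] {n : ℕ} (P : LocalProtocol X Q M O n)

/-- A sample point of a run of the protocol on random inputs: the initial state of the referee, and
the input and the initial state of each agent. -/
abbrev Sample (P : LocalProtocol X Q M O n) : Type (max u v) :=
  P.referee.State × ∀ i, X × (P.agent i).State

/-- The initial configuration at a sample point. -/
def config {P : LocalProtocol X Q M O n} (ω : P.Sample) : P.Config :=
  (ω.1, fun i => (ω.2 i).2)

/-- The history of the first `t` steps at a sample point. -/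
def transcript (t : ℕ) (ω : P.Sample) : ℕ → P.referee.State :=
  P.history t (config ω)

/-- The σ-algebra of what the referee knows after `t` steps. -/
abbrev publicInfo (t : ℕ) : MeasurableSpace P.Sample :=
  MeasurableSpace.comap (P.transcript t) inferInstance

lemma publicInfo_succ (t : ℕ) :
    P.publicInfo (t + 1) = P.publicInfo t ⊔
      MeasurableSpace.comap (fun ω => (P.step^[t + 1] (config ω)).1) inferInstance := by
  rw [publicInfo, show P.transcript (t + 1) = fun ω =>
    consSeq (P.step^[t + 1] (config ω)).1 (P.transcript t ω) from
      funext fun ω => P.history_succ t (config ω), comap_consSeq, sup_comm]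

lemma measurable_refereeState (t : ℕ) :
    Measurable[P.publicInfo t] fun ω => (P.step^[t] (config ω)).1 :=
  (measurable_pi_apply 0).comp (comap_measurable (P.transcript t))

/-- The output of the referee at a sample point. -/
def finalOutput (ω : P.Sample) : O :=
  P.referee.output (P.step^[P.messages] (config ω)).1

lemma measurable_finalOutput : Measurable[P.publicInfo P.messages] P.finalOutput :=
  P.referee.measurable_output.comp (P.measurable_refereeState P.messages)

/-- The state of the referee after `t + 1` steps, provided that it asks agent `i` in the last of
them. -/
def refereeAfterAsking (i : Fin n) (t : ℕ) (ω : P.Sample) : P.referee.State :=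
  P.referee.receive ((P.step^[t] (config ω)).1,
    ((P.agent i).respond ((P.step^[t] (config ω)).2 i,
      (P.referee.query (P.step^[t] (config ω)).1).2)).1)

/-- The agent asked in step `t + 1`. -/
def askedAgent (t : ℕ) (ω : P.Sample) : Fin n :=
  (P.referee.query (P.step^[t] (config ω)).1).1

lemma measurable_askedAgent (t : ℕ) : Measurable[P.publicInfo t] (P.askedAgent t) :=
  measurable_fst.comp (P.referee.measurable_query.comp (P.measurable_refereeState t))

lemma iterate_step_succ_fst (t : ℕ) (ω : P.Sample) :
    (P.step^[t + 1] (config ω)).1 = P.refereeAfterAsking (P.askedAgent t ω) t ω := by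
  rw [Function.iterate_succ_apply']
  rfl

lemma config_update (ω : P.Sample) (i : Fin n) (a : X × (P.agent i).State) :
    config (P := P) (ω.1, Function.update ω.2 i a) =
      ((config ω).1, Function.update (config ω).2 i a.2) := by
  refine Prod.ext rfl (funext fun j => ?_)
  by_cases h : j = i
  · subst h
    simp [config]
  · simp [config, Function.update_of_ne h]

lemma indicator_transcript_update (i : Fin n) (t : ℕ) (c : (ℕ → P.referee.State) → ℝ)
    (ω : P.Sample) (a : X × (P.agent i).State) :
    (P.askedHistories i t)ᶜ.indicator c (P.transcript t (ω.1, Function.update ω.2 i a)) =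
      (P.askedHistories i t)ᶜ.indicator c (P.transcript t ω) := by
  have hmem := history_update_mem_askedHistories (t := t) (c := config ω) a.2
  simp only [transcript, config_update]
  by_cases h : P.history t (config ω) ∈ P.askedHistories i t
  · rw [Set.indicator_of_notMem (by simpa using hmem.2 h),
      Set.indicator_of_notMem (by simpa using h)]
  · rw [history_update_of_not_asked h]

variable [MeasurableSpace X]

lemma measurable_config : Measurable (config (P := P)) :=
  measurable_fst.prodMk <| measurable_pi_lambda _ fun i =>
    ((measurable_pi_apply i).comp measurable_snd).snd

lemma measurable_transcript (t : ℕ) : Measurable (P.transcript t) :=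
  (P.measurable_history t).comp P.measurable_config

lemma measurable_history_update (i : Fin n) (t : ℕ) :
    Measurable fun p : P.Sample × (P.agent i).State =>
      P.history t ((config p.1).1, Function.update (config p.1).2 i p.2) :=
  (P.measurable_history t).comp <| (P.measurable_config.comp measurable_fst).fst.prodMk <|
    measurable_update'.comp <| (P.measurable_config.comp measurable_fst).snd.prodMk measurable_snd

lemma measurable_own (i : Fin n) : Measurable fun ω : P.Sample => ω.2 i :=
  (measurable_pi_apply i).comp measurable_snd

/-- What agent `i` does not know at the start: the initial state of the referee, and the inputs and
the initial states of the other agents. -/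
def others (i : Fin n) (ω : P.Sample) :
    P.referee.State × ∀ j : {j // j ≠ i}, X × (P.agent j).State :=
  (ω.1, fun j => ω.2 j)

lemma measurable_others (i : Fin n) : Measurable (P.others i) :=
  measurable_fst.prodMk <| measurable_pi_lambda _ fun j => P.measurable_own j

/-- The σ-algebra of the input and the initial state of agent `i`. -/
abbrev ownInfo (i : Fin n) : MeasurableSpace P.Sample :=
  MeasurableSpace.comap (fun ω => ω.2 i) inferInstance

/-- The σ-algebra of what agent `i` does not know at the start. -/
abbrev othersInfo (i : Fin n) : MeasurableSpace P.Sample :=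
  MeasurableSpace.comap (P.others i) inferInstance

lemma ownInfo_le_othersInfo {i j : Fin n} (h : j ≠ i) : P.ownInfo j ≤ P.othersInfo i :=
  MeasurableSpace.comap_le_comap_of_eq_comp (fun p => p.2 ⟨j, h⟩)
    ((measurable_pi_apply _).comp measurable_snd) rfl

lemma publicInfo_zero_le_othersInfo (i : Fin n) : P.publicInfo 0 ≤ P.othersInfo i :=
  MeasurableSpace.comap_le_comap_of_eq_comp (fun p _ => p.1)
    (measurable_pi_lambda _ fun _ => measurable_fst)
    (by ext ω l; simp [transcript, history, config, others])

lemma measurable_agentState (i : Fin n) (t : ℕ) :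
    Measurable[P.ownInfo i ⊔ P.publicInfo t] fun ω => (P.step^[t] (config ω)).2 i := by
  induction t with
  | zero => exact measurable_snd.comp ((comap_measurable _).mono le_sup_left le_rfl)
  | succ t ih =>
    have hmono : P.ownInfo i ⊔ P.publicInfo t ≤ P.ownInfo i ⊔ P.publicInfo (t + 1) :=
      sup_le_sup_left (P.publicInfo_succ t ▸ le_sup_left) _
    have hstate := ih.mono hmono le_rfl
    have hquery := P.referee.measurable_query.comp
      ((P.measurable_refereeState t).mono (le_sup_right.trans hmono) le_rfl)
    have hupdate : (fun ω => (P.step^[t + 1] (config ω)).2 i) = fun ω =>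
        if (P.referee.query (P.step^[t] (config ω)).1).1 = i then
          ((P.agent i).respond ((P.step^[t] (config ω)).2 i,
            (P.referee.query (P.step^[t] (config ω)).1).2)).2
        else (P.step^[t] (config ω)).2 i := by
      funext ω
      rw [Function.iterate_succ_apply', step]
      split_ifs with hi
      · subst hi
        simp
      · simp [Function.update_of_ne (Ne.symm hi)]
    rw [hupdate]
    exact .ite (hquery.fst (measurableSet_singleton i))
      ((P.agent i).measurable_respond.comp (hstate.prodMk hquery.snd)).snd hstate

lemma measurable_refereeAfterAsking (i : Fin n) (t : ℕ) :
    Measurable[P.ownInfo i ⊔ P.publicInfo t] (P.refereeAfterAsking i t) := by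
  have hreferee := (P.measurable_refereeState t).mono
    (le_sup_right : _ ≤ P.ownInfo i ⊔ P.publicInfo t) le_rfl
  exact P.referee.measurable_receive.comp <| hreferee.prodMk <| measurable_fst.comp <|
    (P.agent i).measurable_respond.comp <| (P.measurable_agentState i t).prodMk <|
      measurable_snd.comp <| P.referee.measurable_query.comp hreferee

lemma measurable_refereeAfterAsking_other [Nonempty P.referee.State] (i : Fin n) (t : ℕ) :
    Measurable[P.othersInfo i ⊔ P.publicInfo t] fun ω =>
      if P.askedAgent t ω = i then Classical.arbitrary _
      else P.refereeAfterAsking (P.askedAgent t ω) t ω := by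
  let _ : MeasurableSpace P.Sample := P.othersInfo i ⊔ P.publicInfo t
  have hasked : Measurable (P.askedAgent t) := (P.measurable_askedAgent t).mono le_sup_right le_rfl
  have hcase : ∀ j, Measurable fun ω => if j = i then Classical.arbitrary P.referee.State
      else P.refereeAfterAsking j t ω := fun j => by
    by_cases hj : j = i
    · simp only [hj, if_true, measurable_const]
    · simp only [hj, if_false]
      exact (P.measurable_refereeAfterAsking j t).mono
        (sup_le_sup_right (P.ownInfo_le_othersInfo hj) _) le_rfl
  exact (measurable_from_prod_countable_right (f := fun p : Fin n × P.Sample =>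
    if p.1 = i then Classical.arbitrary P.referee.State else P.refereeAfterAsking p.1 t p.2)
    hcase).comp (hasked.prodMk measurable_id)

end Information

section RandomInputs

variable {X : Type v} {Q M : Type u} {O : Type w} [MeasurableSpace X] [Countable X]
  [MeasurableSingletonClass X] [MeasurableSpace Q] [MeasurableSpace M] [MeasurableSpace O] {n : ℕ}
  (P : LocalProtocol X Q M O n)

/-- The law of the initial state of agent `i` as a kernel in its input. -/
def startKernel (i : Fin n) : Kernel X (P.agent i).State :=
  Kernel.ofFunOfCountable (P.agent i).start

instance (i : Fin n) : IsMarkovKernel (P.startKernel i) :=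
  ⟨fun x => (P.agent i).isProbabilityMeasure x⟩

/-- The law of the sample points when the inputs are i.i.d. with law `ν`. -/
def sampleLaw (ν : Measure X) : Measure P.Sample :=
  P.referee.start.prod (Measure.pi fun i => ν ⊗ₘ P.startKernel i)

variable (ν : Measure X) [IsProbabilityMeasure ν]

instance : IsProbabilityMeasure (P.sampleLaw ν) := by
  unfold sampleLaw
  infer_instance

lemma indep_othersInfo_ownInfo (i : Fin n) :
    Indep (P.othersInfo i) (P.ownInfo i) (P.sampleLaw ν) := by
  have h : ∀ (ω : P.Sample) a, P.others i (ω.1, Function.update ω.2 i a) = P.others i ω :=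
    fun ω a => Prod.ext rfl (funext fun j => by simp [others, Function.update_of_ne j.2])
  exact (indepFun_eval_of_update_invariant P.referee.start (fun i => ν ⊗ₘ P.startKernel i)
    (P.measurable_others i) h).symm

lemma condIndepGiven_publicInfo (i : Fin n) (t : ℕ) :
    CondIndepGiven (P.sampleLaw ν) (P.othersInfo i) (P.ownInfo i) (P.publicInfo t) := by
  classical
  have hothers := (P.measurable_others i).comap_le
  have hown := (P.measurable_own i).comap_le
  induction t with
  | zero =>
    simpa using (CondIndepGiven.of_indep hothers hown
      (P.indep_othersInfo_ownInfo ν i)).reveal_left hothers bot_le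
        (le_sup_of_le_left (P.publicInfo_zero_le_othersInfo i))
  | succ t ih =>
    have : Nonempty P.referee.State := nonempty_of_isProbabilityMeasure P.referee.start
    have hpiecewise : (fun ω => (P.step^[t + 1] (config ω)).1) =
        (P.askedAgent t ⁻¹' {i}ᶜ).piecewise
          (fun ω => if P.askedAgent t ω = i then Classical.arbitrary _
            else P.refereeAfterAsking (P.askedAgent t ω) t ω) (P.refereeAfterAsking i t) := by
      funext ω
      rw [iterate_step_succ_fst]
      by_cases hω : P.askedAgent t ω = i <;> simp [Set.piecewise, hω]
    have hasked : MeasurableSet[P.publicInfo t] (P.askedAgent t ⁻¹' {i}ᶜ) :=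
      P.measurable_askedAgent t (measurableSet_singleton i).compl
    rw [publicInfo_succ, hpiecewise]
    exact ih.reveal_piecewise hothers hown (P.measurable_transcript t).comap_le hasked
      (P.measurable_refereeAfterAsking_other i t) (P.measurable_refereeAfterAsking i t)

/-- The law of the transcript of `t` steps when the input of agent `i` is prescribed, whereas the
other inputs are random. -/
def transcriptKernel (i : Fin n) (t : ℕ) : Kernel X (ℕ → P.referee.State) :=
  Kernel.ofFunOfCountable fun x => ((P.sampleLaw ν).prod ((P.agent i).start x)).map fun p =>
    P.history t ((config p.1).1, Function.update (config p.1).2 i p.2)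

variable {P}

instance (i : Fin n) (t : ℕ) : IsMarkovKernel (P.transcriptKernel ν i t) :=
  ⟨fun _ => Measure.isProbabilityMeasure_map (P.measurable_history_update i t).aemeasurable⟩

lemma map_input_transcript (i : Fin n) (t : ℕ) :
    (P.sampleLaw ν).map (fun ω => ((ω.2 i).1, P.transcript t ω)) =
      ν ⊗ₘ P.transcriptKernel ν i t := by
  have hupdate := measurePreserving_update_snd P.referee.start (fun i => ν ⊗ₘ P.startKernel i) i
  have hpair := (P.measurable_own i).fst.prodMk (P.measurable_transcript t)
  have hcomp : (fun ω : P.Sample => ((ω.2 i).1, P.transcript t ω)) ∘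
      (fun p : P.Sample × (X × (P.agent i).State) => (p.1.1, Function.update p.1.2 i p.2)) =
        fun p => (p.2.1, P.history t ((config p.1).1, Function.update (config p.1).2 i p.2.2)) := by
    funext p
    simp only [Function.comp_apply, Function.update_self, transcript, config_update]
  have hresampled := hpair.comp hupdate.measurable
  ext s hs
  conv_lhs => rw [sampleLaw, ← hupdate.map_eq]
  rw [Measure.map_map hpair hupdate.measurable, Measure.map_apply hresampled hs,
    Measure.prod_apply_symm (hresampled hs), Measure.compProd_apply hs,
    Measure.lintegral_compProd (measurable_measure_prodMk_right (hresampled hs)), hcomp]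
  refine lintegral_congr fun x => ?_
  exact ((Measure.map_apply (P.measurable_history_update i t) (measurable_prodMk_left hs)).trans
    (Measure.prod_apply_symm
      (P.measurable_history_update i t (measurable_prodMk_left hs)))).symm

lemma IsDP.map_input_transcript_le {ε : ℝ} (hP : P.IsDP ε 0) (i : Fin n) (t : ℕ) :
    (P.sampleLaw ν).map (fun ω => ((ω.2 i).1, P.transcript t ω)) ≤
      ENNReal.ofReal (Real.exp ε) • ν.prod ((P.sampleLaw ν).map (P.transcript t)) := by
  have hpair := (P.measurable_own i).fst.prodMk (P.measurable_transcript t)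
  have hmarginal : (P.sampleLaw ν).map (P.transcript t) = ν.bind (P.transcriptKernel ν i t) := by
    rw [← Measure.snd_compProd, ← map_input_transcript, Measure.snd,
      Measure.map_map measurable_snd hpair]
    rfl
  rw [hmarginal, map_input_transcript]
  exact compProd_le_of_dpClose ν _ fun x x' =>
    hP.dpClose_history i t (P.sampleLaw ν) P.measurable_config x x'

variable {ν}

lemma measurePreserving_input (i : Fin n) :
    MeasurePreserving (fun ω : P.Sample => (ω.2 i).1) (P.sampleLaw ν) ν :=
  .comp ⟨measurable_fst, Measure.fst_compProd ν (P.startKernel i)⟩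
    ((measurePreserving_eval (fun i => ν ⊗ₘ P.startKernel i) i).comp measurePreserving_snd)

lemma setIntegral_abs_condExp_input_of_not_asked {f : X → ℝ} {C : ℝ} (hC : ∀ x, |f x| ≤ C)
    (hf : ∫ x, f x ∂ν = 0) (i : Fin n) (t : ℕ) :
    ∫ ω in P.transcript t ⁻¹' (P.askedHistories i t)ᶜ,
      |((P.sampleLaw ν)[fun ω => f (ω.2 i).1|P.publicInfo t]) ω| ∂P.sampleLaw ν = 0 := by
  have hfm : Measurable f := measurable_of_countable f
  have hA : MeasurableSet (P.askedHistories i t)ᶜ := (P.measurableSet_askedHistories i t).compl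
  have hinput : Measurable fun ω : P.Sample => f (ω.2 i).1 := hfm.comp (P.measurable_own i).fst
  have hfint : Integrable (fun ω : P.Sample => f (ω.2 i).1) (P.sampleLaw ν) :=
    .of_bound hinput.aestronglyMeasurable C (.of_forall fun ω => hC _)
  have hmean : ∫ ω, f (ω.2 i).1 ∂P.sampleLaw ν = 0 := by
    have hpres := measurePreserving_input (P := P) (ν := ν) i
    rw [← hf, ← integral_map hpres.aemeasurable hfm.aestronglyMeasurable, hpres.map_eq]
  obtain ⟨c, hc, -, hcond⟩ := exists_setIntegral_abs_condExp_eq (P.measurable_transcript t) hfint hA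
  have hcA : Measurable fun ω => (P.askedHistories i t)ᶜ.indicator c (P.transcript t ω) :=
    (hc.indicator hA).comp (P.measurable_transcript t)
  have hindep : IndepFun (fun ω : P.Sample => f (ω.2 i).1)
      (fun ω => (P.askedHistories i t)ᶜ.indicator c (P.transcript t ω)) (P.sampleLaw ν) :=
    (indepFun_eval_of_update_invariant _ (fun i => ν ⊗ₘ P.startKernel i) hcA
      (P.indicator_transcript_update i t c)).comp (hfm.comp measurable_fst) measurable_id
  have hindicator : ((P.transcript t ⁻¹' (P.askedHistories i t)ᶜ).indicator
      fun ω => f (ω.2 i).1 * c (P.transcript t ω)) =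
        fun ω => f (ω.2 i).1 * (P.askedHistories i t)ᶜ.indicator c (P.transcript t ω) := by
    funext ω
    by_cases hω : P.transcript t ω ∈ P.askedHistories i t <;> simp [hω]
  rw [hcond, ← integral_indicator (P.measurable_transcript t hA), hindicator,
    hindep.integral_fun_mul_eq_mul_integral hinput.aestronglyMeasurable hcA.aestronglyMeasurable,
    hmean, zero_mul]

variable {κ : Type*} [Fintype κ] {φ : κ → X → ℝ} {ε : ℝ}

lemma IsDP.sum_integral_abs_condExp_input_le (hP : P.IsDP ε 0) (hbdd : ∀ k x, |φ k x| ≤ 1)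
    (hmean : ∀ k, ∫ x, φ k x ∂ν = 0) (horth : Pairwise fun k l => ∫ x, φ k x * φ l x ∂ν = 0)
    (i : Fin n) (t : ℕ) :
    ∑ k, ∫ ω, |((P.sampleLaw ν)[fun ω => φ k (ω.2 i).1|P.publicInfo t]) ω| ∂P.sampleLaw ν ≤
      Real.exp ε * √(Fintype.card κ) *
        (P.sampleLaw ν).real (P.transcript t ⁻¹' P.askedHistories i t) := by
  have hasked := P.measurableSet_askedHistories i t
  refine le_trans (Finset.sum_le_sum fun k _ => le_of_eq ?_) <|
    sum_setIntegral_abs_condExp_le (P.measurable_own i).fst (P.measurable_transcript t)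
      (fun k => measurable_of_countable (φ k)) hbdd horth (Real.exp_pos ε).le
      (hP.map_input_transcript_le ν i t) hasked
  rw [← integral_add_compl (P.measurable_transcript t hasked) integrable_condExp.abs,
    ← Set.preimage_compl, setIntegral_abs_condExp_input_of_not_asked (hbdd k) (hmean k), add_zero]

lemma sum_measureReal_asked_le (ν : Measure X) [IsProbabilityMeasure ν] (t : ℕ) :
    ∑ i, (P.sampleLaw ν).real (P.transcript t ⁻¹' P.askedHistories i t) ≤ t := by
  have hasked := fun i => P.measurable_transcript t (P.measurableSet_askedHistories i t)
  have hfint : ∀ i, Integrable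
      (fun ω => (P.askedHistories i t).indicator (1 : (ℕ → P.referee.State) → ℝ)
        (P.transcript t ω)) (P.sampleLaw ν) :=
    fun i => (integrable_const (1 : ℝ)).indicator (hasked i)
  calc ∑ i, (P.sampleLaw ν).real (P.transcript t ⁻¹' P.askedHistories i t)
    _ = ∫ ω, ∑ i, (P.askedHistories i t).indicator 1 (P.transcript t ω) ∂P.sampleLaw ν := by
        rw [integral_finsetSum _ fun i _ => hfint i]
        exact Finset.sum_congr rfl fun i _ => (integral_indicator_one (hasked i)).symm
    _ ≤ ∫ _, (t : ℝ) ∂P.sampleLaw ν :=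
        integral_mono (integrable_finsetSum _ fun i _ => hfint i) (integrable_const _) fun ω =>
          P.sum_indicator_askedHistories_le t (P.transcript t ω)
    _ = t := by simp

lemma IsDP.sum_sum_integral_abs_condExp_input_le (hP : P.IsDP ε 0)
    (hbdd : ∀ k x, |φ k x| ≤ 1) (hmean : ∀ k, ∫ x, φ k x ∂ν = 0)
    (horth : Pairwise fun k l => ∫ x, φ k x * φ l x ∂ν = 0) (t : ℕ) :
    ∑ k, ∑ i, ∫ ω, |((P.sampleLaw ν)[fun ω => φ k (ω.2 i).1|P.publicInfo t]) ω| ∂P.sampleLaw ν ≤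
      Real.exp ε * √(Fintype.card κ) * t := by
  rw [Finset.sum_comm]
  refine (Finset.sum_le_sum fun i _ =>
    hP.sum_integral_abs_condExp_input_le hbdd hmean horth i t).trans ?_
  rw [← Finset.mul_sum]
  gcongr
  exact sum_measureReal_asked_le ν t

lemma map_config_sampleLaw (ν : Measure X) [IsProbabilityMeasure ν] :
    (P.sampleLaw ν).map config = (Measure.pi fun _ => ν).bind fun z =>
      P.referee.start.prod (Measure.pi fun i => (P.agent i).start (z i)) := by
  let starts : Kernel (Fin n → X) (∀ i, (P.agent i).State) :=
    ⟨fun z => Measure.pi fun i => P.startKernel i (z i), measurable_pi_kernel P.startKernel⟩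
  have : IsMarkovKernel starts := ⟨fun z => by dsimp [starts]; infer_instance⟩
  have hstates : (Measure.pi fun i => ν ⊗ₘ P.startKernel i).map (fun a i => (a i).2) =
      (Measure.pi fun _ => ν).bind starts := by
    rw [Measure.pi_map_pi (f := fun i => (Prod.snd : X × (P.agent i).State → _))
      fun i => measurable_snd.aemeasurable]
    exact (congrArg Measure.pi (funext fun i => Measure.snd_compProd ν (P.startKernel i))).trans
      (pi_bind (fun _ => ν) P.startKernel)
  have hsnd : Measurable fun (a : ∀ i, X × (P.agent i).State) i => (a i).2 := by fun_prop
  calc (P.sampleLaw ν).map config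
    _ = P.referee.start.prod ((Measure.pi fun _ => ν).bind starts) := by
        rw [← hstates]
        exact (Measure.map_prod_map P.referee.start _ measurable_id hsnd).symm.trans
          (by rw [Measure.map_id])
    _ = _ := prod_bind _ _ _

lemma integral_outcome_measureReal (ν : Measure X) [IsProbabilityMeasure ν] {T : Set O}
    (hT : MeasurableSet T) :
    ∫ z, (P.outcome z).real T ∂Measure.pi (fun _ => ν) =
      (P.sampleLaw ν).real (P.finalOutput ⁻¹' T) := by
  let run : P.Config → O := fun c => P.referee.output (P.step^[P.messages] c).1
  have hrun : Measurable run :=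
    P.referee.measurable_output.comp (P.measurable_step.iterate P.messages).fst
  have hlaw : P.sampleLaw ν (P.finalOutput ⁻¹' T) =
      ∫⁻ z, P.outcome z T ∂Measure.pi fun _ => ν := by
    calc P.sampleLaw ν (config ⁻¹' (run ⁻¹' T))
      _ = (P.sampleLaw ν).map config (run ⁻¹' T) :=
          (Measure.map_apply P.measurable_config (hrun hT)).symm
      _ = _ := by
          rw [map_config_sampleLaw, Measure.bind_apply (hrun hT)
            (measurable_of_countable _).aemeasurable]
          exact lintegral_congr fun z => (Measure.map_apply hrun hT).symm
  rw [measureReal_def, hlaw]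
  exact integral_toReal (measurable_of_countable _).aemeasurable
    (.of_forall fun z => measure_lt_top _ _)

lemma sampleLaw_linearTilt {ν : Measure X} [IsProbabilityMeasure ν] {f : X → ℝ}
    (hbdd : ∀ x, |f x| ≤ 1) (hmean : ∫ x, f x ∂ν = 0) :
    P.sampleLaw (linearTilt ν f) =
      (P.sampleLaw ν).withDensity fun ω => ENNReal.ofReal (∏ i, (1 + f (ω.2 i).1)) := by
  have hprob := isProbabilityMeasure_linearTilt (integrable_of_forall_abs_le hbdd) hbdd hmean
  have hg : Measurable fun x => ENNReal.ofReal (1 + f x) := measurable_of_countable _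
  have hagent : ∀ i, linearTilt ν f ⊗ₘ P.startKernel i =
      (ν ⊗ₘ P.startKernel i).withDensity fun p => ENNReal.ofReal (1 + f p.1) := fun i =>
    have : IsProbabilityMeasure (ν.withDensity fun x => ENNReal.ofReal (1 + f x)) := hprob
    withDensity_compProd_left ν (P.startKernel i) hg
  have (i : Fin n) : IsProbabilityMeasure
      ((ν ⊗ₘ P.startKernel i).withDensity fun p => ENNReal.ofReal (1 + f p.1)) :=
    hagent i ▸ inferInstance
  simp only [sampleLaw, hagent, ENNReal.ofReal_prod_of_nonneg fun _ _ =>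
    one_add_nonneg_of_abs_le_one (hbdd _)]
  rw [pi_withDensity (fun i => ν ⊗ₘ P.startKernel i)
    (f := fun i p => ENNReal.ofReal (1 + f p.1)) fun i => hg.comp measurable_fst,
    prod_withDensity_right]
  exact Finset.measurable_prod _ fun i _ => hg.comp (measurable_pi_apply i).fst

lemma integrable_prod_one_add_input {ν : Measure X} [IsProbabilityMeasure ν] {f : X → ℝ}
    (hbdd : ∀ x, |f x| ≤ 1) :
    Integrable (fun ω : P.Sample => ∏ i, (1 + f (ω.2 i).1)) (P.sampleLaw ν) := by
  have hmeas : Measurable fun ω : P.Sample => ∏ i, (1 + f (ω.2 i).1) :=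
    Finset.measurable_prod _ fun i _ =>
      ((measurable_of_countable f).comp (P.measurable_own i).fst).const_add 1
  refine .of_bound hmeas.aestronglyMeasurable (∏ _ : Fin n, 2) (.of_forall fun ω => ?_)
  rw [Real.norm_eq_abs, Finset.abs_prod]
  exact Finset.prod_le_prod (fun _ _ => abs_nonneg _) fun i _ => abs_le.2 <|
    by constructor <;> linarith [abs_le.1 (hbdd (ω.2 i).1)]

lemma condExp_prod_one_add_input {ν : Measure X} [IsProbabilityMeasure ν] {f : X → ℝ}
    (hbdd : ∀ x, |f x| ≤ 1) (t : ℕ) :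
    (P.sampleLaw ν)[fun ω => ∏ i, (1 + f (ω.2 i).1)|P.publicInfo t] =ᵐ[P.sampleLaw ν] fun ω =>
      ∏ i, (1 + ((P.sampleLaw ν)[fun ω => f (ω.2 i).1|P.publicInfo t]) ω) := by
  have hle := (P.measurable_transcript t).comap_le
  have hf : Measurable f := measurable_of_countable f
  have hinput : ∀ i, Measurable[P.ownInfo i] fun ω => f (ω.2 i).1 := fun i =>
    (hf.comp measurable_fst).comp (comap_measurable fun ω : P.Sample => ω.2 i)
  have hfint : ∀ i, Integrable (fun ω => f (ω.2 i).1) (P.sampleLaw ν) := fun i =>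
    (measurePreserving_input i).integrable_comp_of_integrable (integrable_of_forall_abs_le hbdd)
  have hprod : (P.sampleLaw ν)[∏ i, fun ω => 1 + f (ω.2 i).1|P.publicInfo t] =ᵐ[P.sampleLaw ν]
      ∏ i, (P.sampleLaw ν)[fun ω => 1 + f (ω.2 i).1|P.publicInfo t] :=
    condExp_prod_ae_eq_prod_condExp (C := 2) (fun i => (P.measurable_own i).comap_le)
      (fun i => (P.measurable_others i).comap_le) hle
      (fun i j h => P.ownInfo_le_othersInfo h) (fun i => P.condIndepGiven_publicInfo ν i t)
      (fun i => ((hinput i).const_add 1).stronglyMeasurable)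
      (fun i ω => by linarith [abs_add_le 1 (f (ω.2 i).1), hbdd (ω.2 i).1, abs_one (α := ℝ)]) _
  have hadd : ∀ᵐ ω ∂P.sampleLaw ν, ∀ i,
      ((P.sampleLaw ν)[fun ω => 1 + f (ω.2 i).1|P.publicInfo t]) ω =
        1 + ((P.sampleLaw ν)[fun ω => f (ω.2 i).1|P.publicInfo t]) ω :=
    ae_all_iff.2 fun i => by
      have h := condExp_add (integrable_const (1 : ℝ)) (hfint i) (P.publicInfo t)
      rw [condExp_const hle] at h
      exact h
  filter_upwards [hprod, hadd] with ω hω hωi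
  rw [Finset.prod_fn] at hω
  simp only [hω, Finset.prod_apply, hωi]

lemma measureReal_sub_sum_le_sampleLaw_linearTilt {ν : Measure X} [IsProbabilityMeasure ν]
    {f : X → ℝ} (hbdd : ∀ x, |f x| ≤ 1) (hmean : ∫ x, f x ∂ν = 0) {t : ℕ} {W : Set P.Sample}
    (hW : MeasurableSet[P.publicInfo t] W) :
    (P.sampleLaw ν).real W -
        ∑ i, ∫ ω, |((P.sampleLaw ν)[fun ω => f (ω.2 i).1|P.publicInfo t]) ω| ∂P.sampleLaw ν ≤
      (P.sampleLaw (linearTilt ν f)).real W := by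
  have hle := (P.measurable_transcript t).comap_le
  let b (i : Fin n) : P.Sample → ℝ := (P.sampleLaw ν)[fun ω => f (ω.2 i).1|P.publicInfo t]
  have hb : ∀ᵐ ω ∂P.sampleLaw ν, ∀ i, |b i ω| ≤ 1 := ae_all_iff.2 fun i =>
    ae_bdd_abs_condExp_of_ae_bdd_abs (.of_forall fun ω => hbdd _)
  have hbsum : Integrable (fun ω => ∑ i, |b i ω|) (P.sampleLaw ν) :=
    integrable_finsetSum _ fun i _ => integrable_condExp.abs
  have hprod := P.condExp_prod_one_add_input (ν := ν) hbdd t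
  have hprodi : Integrable (fun ω => ∏ i, (1 + b i ω)) (P.sampleLaw ν) :=
    integrable_condExp.congr hprod
  calc (P.sampleLaw ν).real W - ∑ i, ∫ ω, |b i ω| ∂P.sampleLaw ν
    _ = (P.sampleLaw ν).real W - ∫ ω, ∑ i, |b i ω| ∂P.sampleLaw ν := by
        rw [integral_finsetSum _ fun i _ => integrable_condExp.abs]
    _ ≤ (P.sampleLaw ν).real W - ∫ ω in W, ∑ i, |b i ω| ∂P.sampleLaw ν :=
        sub_le_sub_left (setIntegral_le_integral hbsum
          (.of_forall fun ω => Finset.sum_nonneg fun i _ => abs_nonneg _)) _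
    _ = ∫ ω in W, (1 - ∑ i, |b i ω|) ∂P.sampleLaw ν := by
        rw [integral_sub (integrable_const 1) hbsum.integrableOn]
        simp
    _ ≤ ∫ ω in W, ∏ i, (1 + b i ω) ∂P.sampleLaw ν := by
        refine integral_mono_ae ((integrable_const 1).sub hbsum.integrableOn) hprodi.integrableOn
          (ae_restrict_of_ae ?_)
        filter_upwards [hb] with ω hω
        exact one_sub_sum_abs_le_prod_one_add _ fun i _ => hω i
    _ = ∫ ω in W, ∏ i, (1 + f (ω.2 i).1) ∂P.sampleLaw ν := by
        rw [← setIntegral_condExp hle (P.integrable_prod_one_add_input hbdd) hW]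
        exact integral_congr_ae (ae_restrict_of_ae hprod.symm)
    _ = (P.sampleLaw (linearTilt ν f)).real W := by
        rw [P.sampleLaw_linearTilt hbdd hmean, measureReal_withDensity_ofReal
          (P.integrable_prod_one_add_input hbdd) (fun ω => Finset.prod_nonneg fun i _ =>
            one_add_nonneg_of_abs_le_one (hbdd _)) (hle W hW)]

lemma sum_measureReal_preimage_compl_singleton {Ω O : Type*} [MeasurableSpace Ω] [Fintype O]
    [MeasurableSpace O] [MeasurableSingletonClass O] (μ : Measure Ω) [IsProbabilityMeasure μ]
    {g : Ω → O} (hg : Measurable g) : ∑ k, μ.real (g ⁻¹' {k}ᶜ) = Fintype.card O - 1 := by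
  have hone : ∑ k, μ.real (g ⁻¹' {k}) = 1 := by
    rw [sum_measureReal_preimage_singleton _ fun k _ => hg (measurableSet_singleton k)]
    simp
  simp [Set.preimage_compl, probReal_compl_eq_one_sub (hg (measurableSet_singleton _)), hone]

theorem IsDP.card_sub_le_sum_integral_outcome_linearTilt [Fintype O] [MeasurableSingletonClass O]
    {P : LocalProtocol X Q M O n} {ε : ℝ} (hP : P.IsDP ε 0) {ν : Measure X}
    [IsProbabilityMeasure ν] {φ : O → X → ℝ} (hbdd : ∀ k x, |φ k x| ≤ 1)
    (hmean : ∀ k, ∫ x, φ k x ∂ν = 0) (horth : Pairwise fun k l => ∫ x, φ k x * φ l x ∂ν = 0) :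
    Fintype.card O - 1 - Real.exp ε * √(Fintype.card O) * P.messages ≤
      ∑ k, ∫ z, (P.outcome z).real {k}ᶜ ∂Measure.pi fun _ => linearTilt ν (φ k) := by
  have hprob := fun k =>
    isProbabilityMeasure_linearTilt (integrable_of_forall_abs_le (hbdd k)) (hbdd k) (hmean k)
  have hle := P.measurable_transcript P.messages |>.comap_le
  calc Fintype.card O - 1 - Real.exp ε * √(Fintype.card O) * P.messages
    _ ≤ ∑ k, ((P.sampleLaw ν).real (P.finalOutput ⁻¹' {k}ᶜ) - ∑ i, ∫ ω,
          |((P.sampleLaw ν)[fun ω => φ k (ω.2 i).1|P.publicInfo P.messages]) ω|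
            ∂P.sampleLaw ν) := by
        rw [Finset.sum_sub_distrib, sum_measureReal_preimage_compl_singleton _
          (P.measurable_finalOutput.mono hle le_rfl)]
        exact sub_le_sub_left
          (hP.sum_sum_integral_abs_condExp_input_le hbdd hmean horth P.messages) _
    _ ≤ ∑ k, (P.sampleLaw (linearTilt ν (φ k))).real (P.finalOutput ⁻¹' {k}ᶜ) :=
        Finset.sum_le_sum fun k _ =>
          P.measureReal_sub_sum_le_sampleLaw_linearTilt (hbdd k) (hmean k)
            (P.measurable_finalOutput (measurableSet_singleton k).compl)
    _ = _ := Finset.sum_congr rfl fun k _ =>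
        (P.integral_outcome_measureReal _ (measurableSet_singleton k).compl).symm

end RandomInputs

end LocalProtocol

section Cube

variable {ι : Type*}

/-- The `k`-th coordinate of a point of the discrete cube as a sign; these functions are the
directions in which the uniform law is tilted. -/
def cubeSign (k : ι) (x : ι → Bool) : ℝ := if x k then 1 else -1

lemma abs_cubeSign (k : ι) (x : ι → Bool) : |cubeSign k x| = 1 := by
  unfold cubeSign
  split_ifs <;> simp

lemma cubeSign_mul_self (k : ι) (x : ι → Bool) : cubeSign k x * cubeSign k x = 1 := by
  rw [← abs_mul_abs_self, abs_cubeSign, one_mul]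

lemma setIntegral_coord_eq_true [Finite ι] (μ : Measure (ι → Bool)) (j : ι)
    (f : (ι → Bool) → ℝ) :
    ∫ x in {x | x j = true}, f x ∂μ = (∫ x, f x * (1 + cubeSign j x) ∂μ) / 2 := by
  rw [← integral_indicator (Set.toFinite _).measurableSet, ← integral_div]
  refine integral_congr_ae (.of_forall fun x => ?_)
  by_cases hx : x j <;> simp only [Set.indicator, Set.mem_ofPred_eq, cubeSign, hx] <;> norm_num

variable [Fintype ι]

/-- The law of independent fair coins indexed by `ι`, which is the uniform law on the cube. -/
def uniformCube (ι : Type*) [Fintype ι] : Measure (ι → Bool) :=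
  Measure.pi fun _ => (PMF.uniformOfFintype Bool).toMeasure

instance : IsProbabilityMeasure (uniformCube ι) := by
  unfold uniformCube
  infer_instance

lemma integral_cubeSign (k : ι) : ∫ x, cubeSign k x ∂uniformCube ι = 0 := by
  have h := integral_comp_eval (μ := fun _ : ι => (PMF.uniformOfFintype Bool).toMeasure) (i := k)
    (f := fun b => if b then (1 : ℝ) else -1) (measurable_of_countable _).aestronglyMeasurable
  rw [uniformCube]
  refine h.trans ?_
  simp [PMF.integral_eq_sum]

lemma pairwise_integral_cubeSign_mul_eq_zero :
    Pairwise fun k l : ι => ∫ x, cubeSign k x * cubeSign l x ∂uniformCube ι = 0 := by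
  intro k l hkl
  have hindep : IndepFun (cubeSign k) (cubeSign l) (uniformCube ι) :=
    (iIndepFun_pi (μ := fun _ : ι => (PMF.uniformOfFintype Bool).toMeasure)
      (X := fun _ b => if b then (1 : ℝ) else -1)
      fun _ => (measurable_of_countable _).aemeasurable).indepFun hkl
  rw [hindep.integral_fun_mul_eq_mul_integral (measurable_of_countable _).aestronglyMeasurable
    (measurable_of_countable _).aestronglyMeasurable, integral_cubeSign, zero_mul]

lemma coordMean_linearTilt_cubeSign {d : ℕ} (k j : Fin d) :
    coordMean (linearTilt (uniformCube (Fin d)) (cubeSign k)) j =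
      1 - 1 / 2 * ({k}ᶜ : Set (Fin d)).indicator 1 j := by
  have hfint : ∀ f : (Fin d → Bool) → ℝ, Integrable f (uniformCube (Fin d)) := fun _ => .of_finite
  have hhalf : (uniformCube (Fin d)).real {x | x j = true} = 1 / 2 := by
    rw [← integral_indicator_one (Set.toFinite _).measurableSet,
      integral_indicator (Set.toFinite _).measurableSet, setIntegral_coord_eq_true]
    simp [integral_add, integral_cubeSign]
  rw [coordMean, linearTilt_real (hfint _) (fun x => (abs_cubeSign k x).le)
    (Set.toFinite _).measurableSet, hhalf, setIntegral_coord_eq_true]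
  simp only [mul_add, mul_one]
  rw [integral_add (hfint _) (hfint _), integral_cubeSign]
  obtain rfl | hjk := eq_or_ne j k
  · norm_num [cubeSign_mul_self]
  · norm_num [pairwise_integral_cubeSign_mul_eq_zero hjk.symm, hjk]

end Cube

theorem LocalProtocol.SolvesSelection.integral_outcome_compl_le {d n : ℕ} {Q M : Type u}
    [MeasurableSpace Q] [MeasurableSpace M] {P : LocalProtocol (Fin d → Bool) Q M (Fin d) n}
    {α : ℝ} (hP : P.SolvesSelection α) (k : Fin d) :
    ∫ Y, (P.outcome Y).real {k}ᶜ
      ∂Measure.pi (fun _ => linearTilt (uniformCube (Fin d)) (cubeSign k)) ≤ 2 * α := by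
  have hprob : IsProbabilityMeasure (linearTilt (uniformCube (Fin d)) (cubeSign k)) :=
    isProbabilityMeasure_linearTilt .of_finite (fun x => (abs_cubeSign k x).le)
      (integral_cubeSign k)
  have hvalue : ∀ Y, ∫ j, coordMean (linearTilt (uniformCube (Fin d)) (cubeSign k)) j
      ∂P.outcome Y = 1 - 1 / 2 * (P.outcome Y).real {k}ᶜ := fun Y => by
    simp only [coordMean_linearTilt_cubeSign]
    rw [integral_sub (integrable_const _) .of_finite, integral_const_mul,
      integral_indicator_one (Set.toFinite _).measurableSet]
    simp
  have h := hP _ hprob k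
  simp only [hvalue] at h
  rw [integral_sub (integrable_const _) .of_finite, integral_const_mul,
    coordMean_linearTilt_cubeSign] at h
  simp only [Set.mem_compl_iff, Set.mem_singleton_iff, not_true_eq_false, not_false_eq_true,
    Set.indicator_of_notMem, integral_const, probReal_univ, smul_eq_mul, mul_zero, mul_one] at h
  linarith

theorem mainTheorem7_general {d n : ℕ} {Q M : Type u} [MeasurableSpace Q] [MeasurableSpace M]
    (P : LocalProtocol (Fin d → Bool) Q M (Fin d) n) {ε α : ℝ} (hdp : P.IsDP ε 0)
    (hsel : P.SolvesSelection α) :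
    d - 1 - 2 * α * d ≤ Real.exp ε * √d * P.messages := by
  have hlow := hdp.card_sub_le_sum_integral_outcome_linearTilt (ν := uniformCube (Fin d))
    (fun k x => (abs_cubeSign k x).le) integral_cubeSign pairwise_integral_cubeSign_mul_eq_zero
  have hup := Finset.sum_le_sum fun k (_ : k ∈ Finset.univ) => hsel.integral_outcome_compl_le k
  simp only [Fintype.card_fin, Finset.sum_const, Finset.card_univ, nsmul_eq_mul] at hlow hup
  linarith

lemma rpow_third_div_ten_le {d m : ℝ} (hd : 2 ≤ d) (hm : 0 ≤ m)
    (h : d - 1 - 2 * (1 / 10) * d ≤ Real.exp 1 * √d * m) : 1 / 10 * d ^ (1 / 3 : ℝ) ≤ m := by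
  have hpos : 0 < √d := Real.sqrt_pos.2 (by linarith)
  have hsqrt : √d * √d = d := Real.mul_self_sqrt (by linarith)
  have hexp : Real.exp 1 * √d * m ≤ 3 * √d * m := by
    gcongr
    exact Real.exp_one_lt_d9.le.trans (by norm_num)
  have hm_ge : 1 / 10 * √d ≤ m := le_of_mul_le_mul_left (by nlinarith) hpos
  calc 1 / 10 * d ^ (1 / 3 : ℝ) ≤ 1 / 10 * √d := by
        rw [Real.sqrt_eq_rpow]
        gcongr
        · linarith
        · norm_num
    _ ≤ m := hm_ge

end

theorem mainTheorem7 :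
    ∃ c : ℝ, 0 < c ∧
      ∀ (d : ℕ), 2 ≤ d → ∀ (n : ℕ) (Q M : Type u) [MeasurableSpace Q] [MeasurableSpace M]
        (P : LocalProtocol (Fin d → Bool) Q M (Fin d) n),
        P.IsDP 1 0 → P.SolvesSelection (1 / 10) →
          c * (d : ℝ) ^ (1 / 3 : ℝ) ≤ (P.messages : ℝ) :=
  ⟨1 / 10, by norm_num, fun _ hd _ _ _ _ _ P hdp hsel =>
    rpow_third_div_ten_le (by exact_mod_cast hd) P.messages.cast_nonneg
      (mainTheorem7_general P hdp hsel)⟩
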